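/- Let $\mathcal H$ be a real Hilbert space with closed unit ball $\mathbb B$, $T>0$, $d_S(x)=\inf_{z\in S}\|x-z\|$, and $\operatorname{Haus}$ the (extended-valued) Hausdorff distance. For $S\subset\mathcal H$ and $x\in S$, let $T(S;x)$ be the Clarke tangent cone (the set of $h$ such that for all sequences $x_n\to x$ in $S$ and $t_n\downarrow 0$, $t_n>0$, there are $h_n\to h$ with $x_n+t_nh_n\in S$ for all $n$), and $N(S;x)=\{v:\langle v,h\rangle\le 0\ \forall h\in T(S;x)\}$ the Clarke normal cone; $N(S;x)=\emptyset$ if $x\notin S$. Moving set. Let $C\colon[0,T]\rightrightarrows\mathcal H$ have nonempty closed values with $\operatorname{Haus}(C(t),C(s))\le L_C|t-s|$ for all $t,s\in[0,T]$, for some $L_C\ge 0$. Assume that every $C(t)$ is ball-compact (i.e. $C(t)\cap r\mathbb B$ is compact for all $r>0$), and that the family is equi-uniformly subsmooth: for every $\epsilon>0$ there is $\delta>0$ such that for all $t\in[0,T]$, all $u_1,u_2\in C(t)$ with $\|u_1-u_2\|\le\delta$ and all $\xi_i\in N(C(t);u_i)\cap\mathbb B$, $i=1,2$, one has $\langle \xi_2-\xi_1,u_2-u_1\rangle\ge-\epsilon\|u_2-u_1\|$.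 Perturbation. Let $F\colon[0,T]\times\mathcal H\rightrightarrows\mathcal H$ have nonempty closed convex values such that (1) for every $t\in[0,T]$, $F(t,\cdot)$ is upper semicontinuous from $\mathcal H$ into $\mathcal H$ with the weak topology (the inverse image $\{u:F(t,u)\cap W\ne\emptyset\}$ of each weakly closed set $W$ is closed); (2) there is a Lipschitz continuous $h\colon\mathcal H\to[0,\infty)$ such that for all $u\in\mathcal H$, $d_{F(t,u)}(0)\le h(u)$ for a.e. $t\in[0,T]$; (3) for some $\gamma>0$ there is $f\colon[0,T]\times\mathcal H\to\mathcal H$ with $f(t,u)\in F(t,u)$ and $\|f(t,u)\|^2<d_{F(t,u)}(0)^2+\gamma$ for all $(t,u)$, and with $f(\cdot,u)$ (strongly) measurable for every $u\in\mathcal H$. Algorithm. Fix such $\gamma$ and $f$, and let $x_0\in C(0)$. For $n\ge1$ put $\mu_n=T/n$ and $t^n_k=k\mu_n$, and let $\varepsilon_n,\eta_n>0$ satisfy $\varepsilon_n/\mu_n^2\to0$ and $\eta_n/\mu_n\to0$. For $S\subset \mathcal H$ and $\varepsilon,\eta>0$, an $\varepsilon$-$\eta$ approximate projection of $u$ onto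 $S$ is a point $z$ with $\|u-z\|^2<d_S(u)^2+\varepsilon$ that belongs to some closed set $S_\eta$ with $S\subset S_\eta\subset S+\eta\mathbb B$. For each $n\ge 1$ let $x^n_0=x_0$, and for $k=0,\dots,n-1$ let $x^n_{k+1}$ be any $\varepsilon_n$-$\eta_n$ approximate projection of $x^n_k+\int_{t^n_k}^{t^n_{k+1}}f(s,x^n_k)\,ds$ onto $C(t^n_{k+1})$. Define $x_n\colon[0,T]\to\mathcal H$ by $x_n(0)=x_0$ and, for $t\in\,]t^n_k,t^n_{k+1}]$, $$x_n(t)=x^n_k+\frac{t-t^n_k}{\mu_n}\Big(x^n_{k+1}-x^n_k-\int_{t^n_k}^{t^n_{k+1}}f(s,x^n_k)\,ds\Big)+\int_{t^n_k}^tf(s,x^n_k)\,ds .$$ Theorem. A subsequence of $(x_n)_{n\ge1}$ converges uniformly on $[0,T]$ to a Lipschitz continuous function $x\colon[0,T]\to\mathcal H$ that solves the sweeping process $$\dot x(t)\in-N(C(t);x(t))+F(t,x(t))\ \text{ for a.e. } t\in[0,T],\qquad x(0)=x_0 .$$ -/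

import Mathlib

open Set Filter Topology MeasureTheory
open scoped Pointwise NNReal ENNReal

namespace SweepingProcess

/-- A set is ball compact if its intersection with every closed ball centred at the origin is
compact. -/
def BallCompact {H : Type*} [NormedAddCommGroup H] (S : Set H) : Prop :=
  ∀ r : ℝ, 0 < r → IsCompact (S ∩ Metric.closedBall (0 : H) r)

/-- The Clarke tangent cone `T(S; x)` (sequential definition). -/
def clarkeTangentCone {H : Type*} [NormedAddCommGroup H] [InnerProductSpace ℝ H]
    (S : Set H) (x : H) : Set H :=
  {h | ∀ (u : ℕ → H) (τ : ℕ → ℝ), (∀ n, u n ∈ S) → Tendsto u atTop (𝓝 x) →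
    (∀ n, 0 < τ n) → Tendsto τ atTop (𝓝 0) →
    ∃ g : ℕ → H, Tendsto g atTop (𝓝 h) ∧ ∀ n, u n + τ n • g n ∈ S}

/-- The Clarke normal cone `N(S; x)`: the negative polar of the tangent cone if `x ∈ S`, and the
empty set if `x ∉ S`. -/
def clarkeNormalCone {H : Type*} [NormedAddCommGroup H] [InnerProductSpace ℝ H]
    (S : Set H) (x : H) : Set H :=
  {v | x ∈ S ∧ ∀ h ∈ clarkeTangentCone S x, inner ℝ v h ≤ 0}

/-- The family `(S t)`, `t ∈ I`, is equi-uniformly subsmooth: one `δ` serves all `t ∈ I`. -/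
def EquiUniformlySubsmooth {H : Type*} [NormedAddCommGroup H] [InnerProductSpace ℝ H]
    (I : Set ℝ) (S : ℝ → Set H) : Prop :=
  ∀ ε : ℝ, 0 < ε → ∃ δ : ℝ, 0 < δ ∧ ∀ t ∈ I, ∀ x₁ ∈ S t, ∀ x₂ ∈ S t, ‖x₁ - x₂‖ ≤ δ →
    ∀ ξ₁ ∈ clarkeNormalCone (S t) x₁ ∩ Metric.closedBall 0 1,
    ∀ ξ₂ ∈ clarkeNormalCone (S t) x₂ ∩ Metric.closedBall 0 1,
      -ε * ‖x₂ - x₁‖ ≤ inner ℝ (ξ₂ - ξ₁) (x₂ - x₁)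

/-- Upper semicontinuity of a set-valued map from `H` with its norm topology into `H` with its
weak topology: the inverse image of every weakly closed set is closed. -/
def UpperSemicontinuousToWeak {H : Type*} [NormedAddCommGroup H] [InnerProductSpace ℝ H]
    (G : H → Set H) : Prop :=
  ∀ W : Set (WeakSpace ℝ H), IsClosed W →
    IsClosed {x : H | ∃ y ∈ G x, toWeakSpace ℝ H y ∈ W}

/-- The `ε`-approximate projections of `x` onto `S`. -/
def approxProj {H : Type*} [NormedAddCommGroup H] (S : Set H) (ε : ℝ) (x : H) : Set H :=
  {z | z ∈ S ∧ ‖x - z‖ ^ 2 < Metric.infDist x S ^ 2 + ε}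

/-- The `ε`-`η` approximate projections of `x` onto `S`. The closed set `E` with
`S ⊆ E ⊆ S + η𝔹` in which the point has to lie may be any such set, so all choices are allowed. -/
def inexactProj {H : Type*} [NormedAddCommGroup H] (S : Set H) (ε η : ℝ) (x : H) : Set H :=
  {z | ∃ E : Set H, IsClosed E ∧ S ⊆ E ∧ E ⊆ S + Metric.closedBall (0 : H) η ∧
    z ∈ E ∧ ‖x - z‖ ^ 2 < Metric.infDist x S ^ 2 + ε}

/-- The node `t_k^n = k T / n` of the uniform partition of `[0, T]` into `n` intervals. -/
noncomputable def node (T : ℝ) (n k : ℕ) : ℝ := k * (T / n)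

/-- `p 0, …, p n` are iterates of the inexact catching-up algorithm with `n` steps of length
`T / n` and tolerances `ε`, `η`, and `x` is the continuous curve through them that the algorithm
associates with them on `[0, T]`. -/
structure IsInexactCatchingUp {H : Type*} [NormedAddCommGroup H] [InnerProductSpace ℝ H]
    (T : ℝ) (C : ℝ → Set H) (f : ℝ → H → H) (x₀ : H) (n : ℕ) (ε η : ℝ)
    (p : ℕ → H) (x : ℝ → H) : Prop where
  start : p 0 = x₀
  step : ∀ k < n, p (k + 1) ∈ inexactProj (C (node T n (k + 1))) ε η
    (p k + ∫ s in (node T n k)..(node T n (k + 1)), f s (p k))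
  curve_zero : x 0 = x₀
  curve : ∀ k < n, ∀ t ∈ Ioc (node T n k) (node T n (k + 1)),
    x t = p k
      + ((t - node T n k) / (T / n)) •
          (p (k + 1) - p k - ∫ s in (node T n k)..(node T n (k + 1)), f s (p k))
      + ∫ s in (node T n k)..t, f s (p k)

/-- `x` is a Lipschitz continuous solution on `[0, T]` of the sweeping process
`x'(t) ∈ -N(C(t); x(t)) + F(t, x(t))` a.e., `x(0) = x₀`. -/
def IsLipschitzSolution {H : Type*} [NormedAddCommGroup H] [InnerProductSpace ℝ H]
    (T : ℝ) (C : ℝ → Set H) (F : ℝ → H → Set H) (x₀ : H) (x : ℝ → H) : Prop :=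
  (∃ K : ℝ≥0, LipschitzOnWith K x (Icc 0 T)) ∧ x 0 = x₀ ∧
    ∀ᵐ t ∂(volume.restrict (Icc 0 T)), ∃ v : H, HasDerivWithinAt x v (Icc 0 T) t ∧
      v ∈ -clarkeNormalCone (C t) (x t) + F t (x t)

end SweepingProcess

/-!
The solution is obtained by compactness of the interpolated curves `x n`, and the differential
inclusion by passing to the limit in their velocities, without any weak topology on function spaces.

*A priori bounds.* The increment of the iterates at each step is at most twice the integral of the
drift plus terms of the order of the step length `T / n`, and the drift grows at most linearly. A
discrete Grönwall inequality (`IsInexactCatchingUp.bounds`) bounds the two parts of the velocity of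
`x n`, the drift `driftVelocity` and the projection part `projVelocity`, uniformly in `n`. Hence the
curves are equi-Lipschitz; they stay close to the ball-compact sets `C t`, and the Arzelà–Ascoli
theorem gives a uniformly convergent subsequence, with limit `y t ∈ C t`.

*Velocities.* A bounded sequence in a Hilbert space has strongly convergent forward convex
combinations (`exists_tendsto_convexHull_tail`). Applied in `L²` to the pairs (drift, projection
part), this gives `y' = a' + b'` almost everywhere, where for almost every `t` the values `a' t` and
`b' t` lie in the closed convex hulls of all tails of the corresponding sequences at `t`
(`exists_velocity_of_tendsto`). It remains to see that both inclusions survive such limits for each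
fixed `t`.

*Drift.* The value `a' t` lies in `F t (y t)`: otherwise a closed half-space separates them, and upper
semicontinuity, applied to this weakly closed half-space, excludes it
(`UpperSemicontinuousToWeak.mem_of_tendsto`).

*Normals.* An inexact projection `z` of `q` onto `S` is close to a point `s ∈ S` that almost minimises
`‖q - u‖²` over `u ∈ S`. By ball-compactness `‖q - u‖² + ‖u - s‖²` has an exact minimiser on `S`; it is
close to `s`, and its optimality condition is an exact normal close to `q - z`
(`exists_normal_near_of_almost_nearest`). After division by the step length the error still tends to
zero, because `ε = o((T / n)²)` and `η = o(T / n)`. Equi-uniform subsmoothness makes these normals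
Fréchet normals with a modulus independent of the set, and the resulting inequality is affine in the
normal, so that it passes to limits of convex combinations; Fréchet normals are Clarke normals, so
that `-b' t` is a normal to `C t` at `y t`
(`EquiUniformlySubsmooth.neg_mem_clarkeNormalCone_of_tendsto`).
-/

namespace SweepingProcess

/-! ### Normals to subsmooth and to ball-compact sets -/

section Normals

variable {H : Type*} [NormedAddCommGroup H] [InnerProductSpace ℝ H]

/-- Fréchet normals are Clarke normals: it suffices to test a tangent vector along the constant
sequence at the base point. -/
theorem mem_clarkeNormalCone_of_frechet {S : Set H} {u ξ : H} (hu : u ∈ S)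
    (hξ : ∀ ε : ℝ, 0 < ε → ∃ δ : ℝ, 0 < δ ∧ ∀ u' ∈ S, ‖u' - u‖ ≤ δ →
      inner ℝ ξ (u' - u) ≤ ε * ‖u' - u‖) :
    ξ ∈ clarkeNormalCone S u := by
  refine ⟨hu, fun d hd => ?_⟩
  obtain ⟨g, hg, hgS⟩ := hd (fun _ => u) (fun n : ℕ => 1 / ((n : ℝ) + 1)) (fun _ => hu)
    tendsto_const_nhds (fun n => by positivity) tendsto_one_div_add_atTop_nhds_zero_nat
  have key : ∀ ε : ℝ, 0 < ε → inner ℝ ξ d ≤ ε * ‖d‖ := by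
    intro ε hε
    obtain ⟨δ, hδ, H1⟩ := hξ ε hε
    have hsmall : Tendsto (fun n : ℕ => ‖(1 / ((n : ℝ) + 1)) • g n‖) atTop (𝓝 0) := by
      have := (tendsto_one_div_add_atTop_nhds_zero_nat (𝕜 := ℝ)).smul hg
      simpa using this.norm
    have hev : ∀ᶠ n in atTop, inner ℝ ξ (g n) ≤ ε * ‖g n‖ := by
      filter_upwards [hsmall.eventually (ge_mem_nhds hδ)] with n hn
      have hpos : 0 < 1 / ((n : ℝ) + 1) := by positivity
      have h2 := H1 _ (hgS n) (by simpa using hn)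
      rw [add_sub_cancel_left, inner_smul_right, norm_smul, Real.norm_of_nonneg hpos.le] at h2
      refine le_of_mul_le_mul_left ?_ hpos
      linarith
    exact le_of_tendsto_of_tendsto (tendsto_const_nhds.inner hg) (hg.norm.const_mul ε) hev
  refine le_of_forall_pos_le_add fun e he => ?_
  have := key (e / (‖d‖ + 1)) (by positivity)
  have h3 : e / (‖d‖ + 1) * ‖d‖ ≤ e := by
    rw [div_mul_eq_mul_div, div_le_iff₀ (by positivity)]
    nlinarith [norm_nonneg d]
  linarith

theorem zero_mem_clarkeNormalCone {S : Set H} {u : H} (hu : u ∈ S) :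
    (0 : H) ∈ clarkeNormalCone S u :=
  ⟨hu, fun h _ => by simp⟩

theorem smul_mem_clarkeNormalCone {S : Set H} {u ξ : H} (hξ : ξ ∈ clarkeNormalCone S u) {c : ℝ}
    (hc : 0 ≤ c) : c • ξ ∈ clarkeNormalCone S u := by
  refine ⟨hξ.1, fun h hh => ?_⟩
  rw [real_inner_smul_left]
  exact mul_nonpos_of_nonneg_of_nonpos hc (hξ.2 h hh)

/-- In an equi-uniformly subsmooth family, bounded Clarke normals are Fréchet normals, uniformly
in the set, the base point and the normal: compare the normal with the zero normal at the other
point. -/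
theorem EquiUniformlySubsmooth.inner_le {I : Set ℝ} {S : ℝ → Set H}
    (hS : EquiUniformlySubsmooth I S) {M ε : ℝ} (hM : 0 < M) (hε : 0 < ε) :
    ∃ δ : ℝ, 0 < δ ∧ ∀ t ∈ I, ∀ u, ∀ ξ ∈ clarkeNormalCone (S t) u, ‖ξ‖ ≤ M →
      ∀ u' ∈ S t, ‖u' - u‖ ≤ δ → inner ℝ ξ (u' - u) ≤ ε * ‖u' - u‖ := by
  obtain ⟨δ, hδ, H1⟩ := hS (ε / M) (by positivity)
  refine ⟨δ, hδ, fun t ht u ξ hξ hξM u' hu' hd => ?_⟩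
  have h1 := H1 t ht u hξ.1 u' hu' (by rwa [norm_sub_rev]) (M⁻¹ • ξ)
    ⟨smul_mem_clarkeNormalCone hξ (by positivity), by
      rw [mem_closedBall_zero_iff, norm_smul, Real.norm_of_nonneg (by positivity),
        inv_mul_le_iff₀ hM]
      simpa using hξM⟩ 0 ⟨zero_mem_clarkeNormalCone hu', by simp⟩
  rw [zero_sub, inner_neg_left, real_inner_smul_left] at h1
  have h2 : M⁻¹ * inner ℝ ξ (u' - u) ≤ ε / M * ‖u' - u‖ := by linarith
  rw [inv_mul_le_iff₀ hM] at h2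
  calc _ ≤ _ := h2
    _ = _ := by field_simp

/-- Perturbing the squared distance to `q` by the squared distance to a near-minimiser `s` gives a
problem with an exact minimiser close to `s`; its optimality condition is a proximal, hence a
Clarke, normal close to `q - s`. -/
theorem exists_normal_near_of_almost_nearest {S : Set H} (hS : BallCompact S) {q s : H}
    (hs : s ∈ S) {ρ : ℝ} (hρ : ‖q - s‖ ^ 2 ≤ Metric.infDist q S ^ 2 + ρ) :
    ∃ u ξ : H, ξ ∈ clarkeNormalCone S u ∧ ‖u - s‖ ≤ √ρ ∧ ‖ξ - (q - s)‖ ≤ 2 * √ρ := by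
  have hcomp := hS (‖s‖ + ‖q - s‖ + 1) (by positivity)
  have hsK : s ∈ S ∩ Metric.closedBall (0 : H) (‖s‖ + ‖q - s‖ + 1) :=
    ⟨hs, by rw [mem_closedBall_zero_iff]; linarith [norm_nonneg (q - s)]⟩
  have hcont : Continuous fun u : H => ‖q - u‖ ^ 2 + ‖u - s‖ ^ 2 := by fun_prop
  obtain ⟨u, ⟨huS, -⟩, humin⟩ := hcomp.exists_isMinOn ⟨s, hsK⟩ hcont.continuousOn
  have hmin : ∀ u' ∈ S, ‖q - u‖ ^ 2 + ‖u - s‖ ^ 2 ≤ ‖q - u'‖ ^ 2 + ‖u' - s‖ ^ 2 := by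
    intro u' hu'
    by_cases hb : ‖u'‖ ≤ ‖s‖ + ‖q - s‖ + 1
    · exact humin ⟨hu', by simpa using hb⟩
    · have h1 : ‖q - u‖ ^ 2 + ‖u - s‖ ^ 2 ≤ ‖q - s‖ ^ 2 + ‖s - s‖ ^ 2 := humin hsK
      have h2 : ‖u'‖ ≤ ‖u' - s‖ + ‖s‖ := by
        simpa using norm_add_le (u' - s) s
      have h3 : ‖q - s‖ ≤ ‖u' - s‖ := by linarith
      have h4 : ‖q - s‖ ^ 2 ≤ ‖u' - s‖ ^ 2 := by gcongr
      rw [sub_self, norm_zero] at h1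
      nlinarith [sq_nonneg ‖q - u'‖]
  have hus : ‖u - s‖ ≤ √ρ := by
    apply Real.le_sqrt_of_sq_le
    have h1 := hmin s hs
    have h2 : Metric.infDist q S ^ 2 ≤ ‖q - u‖ ^ 2 := by
      have := Metric.infDist_le_dist_of_mem (x := q) huS
      rw [dist_eq_norm] at this
      have h0 : 0 ≤ Metric.infDist q S := Metric.infDist_nonneg
      gcongr
    rw [sub_self, norm_zero] at h1
    linarith
  refine ⟨u, (q - u) - (u - s), ?_, hus, ?_⟩
  · -- optimality gives the proximal normal inequality `⟪ξ, u' - u⟫ ≤ ‖u' - u‖ ^ 2`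
    refine mem_clarkeNormalCone_of_frechet huS fun ε hε => ⟨ε, hε, fun u' hu' hd => ?_⟩
    have h1 := hmin u' hu'
    have e1 : ‖q - u'‖ ^ 2 = ‖q - u‖ ^ 2 - 2 * inner ℝ (q - u) (u' - u) + ‖u' - u‖ ^ 2 := by
      rw [← norm_sub_sq_real]; congr 2; abel
    have e2 : ‖u' - s‖ ^ 2 = ‖u - s‖ ^ 2 + 2 * inner ℝ (u - s) (u' - u) + ‖u' - u‖ ^ 2 := by
      rw [← norm_add_sq_real]; congr 2; abel
    rw [inner_sub_left]
    nlinarith [norm_nonneg (u' - u)]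
  · have : (q - u) - (u - s) - (q - s) = (-2 : ℝ) • (u - s) := by
      rw [neg_smul, two_smul]; abel
    rw [this, norm_smul]
    norm_num
    linarith

/-- Near an inexact projection `z` of `q` there is an exact normal close to `q - z`. -/
theorem exists_normal_near_of_mem_inexactProj {S : Set H} (hS : BallCompact S) {q z : H} {ε η : ℝ}
    (hz : z ∈ inexactProj S ε η q) :
    ∃ u ξ : H, ξ ∈ clarkeNormalCone S u ∧ ‖u - z‖ ≤ √(ε + 2 * η * ‖q - z‖ + η ^ 2) + η ∧
      ‖ξ - (q - z)‖ ≤ 2 * √(ε + 2 * η * ‖q - z‖ + η ^ 2) + η := by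
  obtain ⟨E, -, -, hES, hzE, hzd⟩ := hz
  obtain ⟨s, hs, b, hb, rfl⟩ := hES hzE
  rw [mem_closedBall_zero_iff] at hb
  have h1 : ‖q - s‖ ≤ ‖q - (s + b)‖ + η := by
    calc ‖q - s‖ = ‖(q - (s + b)) + b‖ := by congr 1; abel
      _ ≤ _ := (norm_add_le _ _).trans (by gcongr)
  have h2 : ‖q - s‖ ^ 2 ≤ (‖q - (s + b)‖ + η) ^ 2 := by gcongr
  obtain ⟨u, ξ, hξ, hu, hξ'⟩ := exists_normal_near_of_almost_nearest hS hs
    (q := q) (ρ := ε + 2 * η * ‖q - (s + b)‖ + η ^ 2) (by dsimp only at hzd; nlinarith)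
  refine ⟨u, ξ, hξ, ?_, ?_⟩
  · calc ‖u - (s + b)‖ = ‖(u - s) - b‖ := by congr 1; abel
      _ ≤ _ := (norm_sub_le _ _).trans (by gcongr)
  · calc ‖ξ - (q - (s + b))‖ = ‖(ξ - (q - s)) + b‖ := by congr 1; abel
      _ ≤ _ := (norm_add_le _ _).trans (by gcongr)

end Normals

/-! ### Strong limits of forward convex combinations -/

section ConvexCombinations

/-- A bounded sequence in a Hilbert space has strongly convergent forward convex combinations: take
them of almost minimal norm in the convex hulls of the tails; the minimal norms converge, and the
parallelogram identity turns this into the Cauchy property. -/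
theorem exists_tendsto_convexHull_tail {E : Type*} [NormedAddCommGroup E] [InnerProductSpace ℝ E]
    [CompleteSpace E] {u : ℕ → E} {M : ℝ} (hu : ∀ n, ‖u n‖ ≤ M) :
    ∃ (z : ℕ → E) (l : E), (∀ n, z n ∈ convexHull ℝ (u '' Ici n)) ∧ Tendsto z atTop (𝓝 l) := by
  set K : ℕ → Set E := fun n => convexHull ℝ (u '' Ici n) with hK
  have hKne : ∀ n, (K n).Nonempty := fun n =>
    ⟨u n, subset_convexHull ℝ _ ⟨n, mem_Ici.2 le_rfl, rfl⟩⟩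
  have hKanti : Antitone K := fun m n hmn =>
    convexHull_mono (image_mono (Ici_subset_Ici.2 hmn))
  set D : ℕ → ℝ := fun n => Metric.infDist 0 (K n) with hD
  have hDmono : Monotone D := fun m n hmn =>
    Metric.infDist_le_infDist_of_subset (hKanti hmn) (hKne n)
  have hDle : ∀ n, D n ≤ M := fun n => by
    have := Metric.infDist_le_dist_of_mem (x := (0 : E)) (s := K n)
      (subset_convexHull ℝ _ ⟨n, mem_Ici.2 le_rfl, rfl⟩ : u n ∈ K n)
    rw [dist_zero_left] at this
    exact this.trans (hu n)
  have hD0 : ∀ n, 0 ≤ D n := fun n => Metric.infDist_nonneg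
  obtain ⟨d, hd⟩ : ∃ d, Tendsto D atTop (𝓝 d) :=
    ⟨_, tendsto_atTop_ciSup hDmono ⟨M, by rintro _ ⟨n, rfl⟩; exact hDle n⟩⟩
  have hz : ∀ n : ℕ, ∃ z ∈ K n, ‖z‖ < D n + 1 / ((n : ℝ) + 1) := fun n => by
    have hpos : 0 < 1 / ((n : ℝ) + 1) := by positivity
    obtain ⟨z, hz, hz'⟩ := (Metric.infDist_lt_iff (hKne n)).1
      (lt_add_of_pos_right (D n) hpos)
    exact ⟨z, hz, by simpa using hz'⟩
  choose z hzK hzn using hz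
  set b : ℕ → ℝ := fun n => D n + 1 / ((n : ℝ) + 1)
  have hb : Tendsto b atTop (𝓝 d) := by
    simpa only [add_zero] using hd.add (tendsto_one_div_add_atTop_nhds_zero_nat (𝕜 := ℝ))
  have hDd : ∀ n, D n ≤ d := fun n => hDmono.ge_of_tendsto hd n
  -- the midpoint of `z m` and `z n` lies in the hull of the tail from `m`
  have hpar : ∀ m n, m ≤ n → ‖z m - z n‖ ^ 2 ≤ 2 * b m ^ 2 + 2 * b n ^ 2 - 4 * D m ^ 2 := by
    intro m n hmn
    have hmid : (1 / 2 : ℝ) • z m + (1 / 2 : ℝ) • z n ∈ K m :=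
      convex_convexHull ℝ _ (hzK m) (hKanti hmn (hzK n)) (by norm_num) (by norm_num) (by norm_num)
    have h1 := Metric.infDist_le_dist_of_mem (x := (0 : E)) hmid
    rw [dist_zero_left, ← smul_add, norm_smul] at h1
    norm_num at h1
    have h2 : 2 * D m ≤ ‖z m + z n‖ := by simp only [hD]; linarith
    have h3 : (2 * D m) ^ 2 ≤ ‖z m + z n‖ ^ 2 := by
      have := hD0 m
      gcongr
    have h4 := parallelogram_law_with_norm ℝ (z m) (z n)
    have h5 : ‖z m‖ ^ 2 ≤ b m ^ 2 := by have := (hzn m).le; gcongr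
    have h6 : ‖z n‖ ^ 2 ≤ b n ^ 2 := by have := (hzn n).le; gcongr
    nlinarith
  have hcau : CauchySeq z := by
    rw [Metric.cauchySeq_iff']
    intro e he
    have hd2 : Tendsto (fun m => d ^ 2 - D m ^ 2) atTop (𝓝 0) := by
      have := (hd.pow 2).const_sub (d ^ 2)
      rwa [sub_self] at this
    have hbd : Tendsto (fun m => b m ^ 2 - d ^ 2) atTop (𝓝 0) := by
      have := (hb.pow 2).sub_const (d ^ 2)
      rwa [sub_self] at this
    have he2 : 0 < e ^ 2 / 16 := by positivity
    obtain ⟨N, hN⟩ := eventually_atTop.1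
      ((hd2.eventually (gt_mem_nhds he2)).and (hbd.eventually (gt_mem_nhds he2)))
    refine ⟨N, fun n hn => ?_⟩
    have h1 := hpar N n hn
    have h2 := hN N le_rfl
    have h3 := hN n hn
    rw [dist_comm, dist_eq_norm]
    refine lt_of_pow_lt_pow_left₀ 2 he.le ?_
    nlinarith [h2.1, h2.2, h3.2, sq_nonneg e]
  obtain ⟨l, hl⟩ := cauchySeq_tendsto_of_complete hcau
  exact ⟨z, l, hzK, hl⟩

/-- The limit of points of the convex hulls of the tails of a convergent sequence is the limit of
the sequence. -/
theorem tendsto_of_mem_convexHull_tail {E : Type*} [NormedAddCommGroup E] [NormedSpace ℝ E]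
    {u z : ℕ → E} {c : E} (hu : Tendsto u atTop (𝓝 c))
    (hz : ∀ n, z n ∈ convexHull ℝ (u '' Ici n)) : Tendsto z atTop (𝓝 c) := by
  rw [Metric.tendsto_atTop] at hu ⊢
  intro e he
  obtain ⟨N, hN⟩ := hu e he
  refine ⟨N, fun n hn => ?_⟩
  have : convexHull ℝ (u '' Ici n) ⊆ Metric.ball c e :=
    convexHull_min (by rintro _ ⟨m, hm, rfl⟩; exact hN m (hn.trans hm)) (convex_ball c e)
  exact this (hz n)

/-- A substitute for weak compactness: a uniformly bounded sequence of functions on a finite measure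
space has a function `v` which almost everywhere lies in the closed convex hull of every tail of the
sequence, and whose integral over any set is the limit of the integrals of the sequence, if these
converge. It is the strong `L²` limit of forward convex combinations. -/
theorem exists_mem_closure_convexHull_tail {α E : Type*} [MeasurableSpace α] {μ : Measure α}
    [IsFiniteMeasure μ] [NormedAddCommGroup E] [InnerProductSpace ℝ E] [CompleteSpace E]
    {u : ℕ → α → E} {M : ℝ} (hum : ∀ n, AEStronglyMeasurable (u n) μ)
    (hub : ∀ n, ∀ᵐ a ∂μ, ‖u n a‖ ≤ M) :
    ∃ v : α → E, Integrable v μ ∧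
      (∀ᵐ a ∂μ, ∀ N, v a ∈ closure (convexHull ℝ ((fun n => u n a) '' Ici N))) ∧
      ∀ A, MeasurableSet A → ∀ (L : E →L[ℝ] ℝ) (c : ℝ),
        Tendsto (fun n => L (∫ a in A, u n a ∂μ)) atTop (𝓝 c) → L (∫ a in A, v a ∂μ) = c := by
  have hmem : ∀ n, MemLp (u n) 2 μ := fun n => MemLp.of_bound (hum n) M (hub n)
  set U : ℕ → Lp E 2 μ := fun n => (hmem n).toLp (u n) with hU
  obtain ⟨z, l, hz, hl⟩ := exists_tendsto_convexHull_tail (u := U)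
    (M := (μ univ).toNNReal ^ (2 : ℝ≥0∞).toReal⁻¹ * max M 0) (fun n => by
      refine Lp.norm_le_of_ae_bound (le_max_right _ _) ?_
      filter_upwards [(hmem n).coeFn_toLp, hub n] with a h1 h2
      rw [h1]
      exact h2.trans (le_max_left _ _))
  refine ⟨l, (Lp.memLp l).integrable one_le_two, ?_, ?_⟩
  · have hzae : ∀ n, ∀ᵐ a ∂μ, z n a ∈ convexHull ℝ ((fun m => u m a) '' Ici n) := by
      intro n
      have hsub : convexHull ℝ (U '' Ici n) ⊆
          {g : Lp E 2 μ | ∀ᵐ a ∂μ, g a ∈ convexHull ℝ ((fun m => u m a) '' Ici n)} := by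
        refine convexHull_min ?_ ?_
        · rintro _ ⟨m, hm, rfl⟩
          filter_upwards [(hmem m).coeFn_toLp] with a ha
          rw [ha]
          exact subset_convexHull ℝ _ ⟨m, hm, rfl⟩
        · intro g hg g' hg' s t hs ht hst
          filter_upwards [hg, hg', Lp.coeFn_add (s • g) (t • g'), Lp.coeFn_smul s g,
            Lp.coeFn_smul t g'] with a h1 h2 h3 h4 h5
          rw [h3, Pi.add_apply, h4, h5]
          exact convex_convexHull ℝ _ h1 h2 hs ht hst
      exact hsub (hz n)
    obtain ⟨ψ, hψ, hψl⟩ := (tendstoInMeasure_of_tendsto_Lp hl).exists_seq_tendsto_ae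
    filter_upwards [ae_all_iff.2 hzae, hψl] with a h1 h2 N
    refine mem_closure_of_tendsto h2 ?_
    filter_upwards [eventually_ge_atTop N] with j hj
    exact convexHull_mono (image_mono (Ici_subset_Ici.2 (hj.trans (hψ.id_le j)))) (h1 (ψ j))
  · intro A hA L c hc
    -- `Λ g = L (∫ a in A, g a)` is a continuous functional on `L²`
    set w : E := (InnerProductSpace.toDual ℝ E).symm L with hw
    set Λ : Lp E 2 μ →L[ℝ] ℝ :=
      innerSL ℝ (indicatorConstLp 2 hA (measure_ne_top μ A) w) with hΛ
    have hΛe : ∀ g : Lp E 2 μ, Λ g = L (∫ a in A, g a ∂μ) := fun g => by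
      rw [hΛ, innerSL_apply_apply, L2.inner_indicatorConstLp_eq_inner_setIntegral, hw,
        InnerProductSpace.toDual_symm_apply]
    have hΛU : ∀ n, Λ (U n) = L (∫ a in A, u n a ∂μ) := fun n => by
      rw [hΛe]
      congr 1
      exact integral_congr_ae (ae_restrict_of_ae (hmem n).coeFn_toLp)
    have h1 : Tendsto (fun n => Λ (z n)) atTop (𝓝 c) := by
      refine tendsto_of_mem_convexHull_tail (u := fun n => Λ (U n)) (by simpa only [hΛU] using hc)
        fun n => ?_
      have := mem_image_of_mem (Λ : Lp E 2 μ →ₗ[ℝ] ℝ) (hz n)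
      rw [LinearMap.image_convexHull, image_image] at this
      exact this
    have h2 : Tendsto (fun n => Λ (z n)) atTop (𝓝 (Λ l)) := (Λ.continuous.tendsto l).comp hl
    rw [← hΛe]
    exact tendsto_nhds_unique h2 h1

end ConvexCombinations

/-! ### Compactness of sequences of equi-Lipschitz curves -/

section Compactness

theorem exists_subseq_tendstoUniformlyOn_of_lipschitzOnWith {E : Type*} [NormedAddCommGroup E]
    {a b : ℝ} {K : ℝ≥0} {u : ℕ → ℝ → E} (hu : ∀ n, LipschitzOnWith K (u n) (Icc a b))
    (hQ : ∀ t ∈ Icc a b, ∃ Q : Set E, IsCompact Q ∧ ∀ n, u n t ∈ Q) :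
    ∃ (φ : ℕ → ℕ) (y : ℝ → E), StrictMono φ ∧
      TendstoUniformlyOn (fun j => u (φ j)) y atTop (Icc a b) ∧
      LipschitzOnWith K y (Icc a b) := by
  choose! Q hQc hQu using hQ
  have hg : ∀ n, LipschitzWith K ((Icc a b).domRestrict (u n)) := fun n => (hu n).to_restrict
  set g : ℕ → C(Icc a b, E) := fun n => ⟨(Icc a b).domRestrict (u n), (hg n).continuous⟩ with hgdef
  set S : Set C(Icc a b, E) := {f | LipschitzWith K f ∧ ∀ t : Icc a b, f t ∈ Q t} with hS
  have hScomp : IsCompact S := by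
    refine ArzelaAscoli.isCompact_of_equicontinuous S ?_ ?_
    · have himg : ContinuousMap.toFun '' S =
          {f : Icc a b → E | LipschitzWith K f} ∩ univ.pi fun t : Icc a b => Q t := by
        ext f
        constructor
        · rintro ⟨f, hf, rfl⟩
          exact ⟨hf.1, fun t _ => hf.2 t⟩
        · rintro ⟨h1, h2⟩
          exact ⟨⟨f, h1.continuous⟩, ⟨h1, fun t => h2 t trivial⟩, rfl⟩
      rw [himg]
      refine (isCompact_univ_pi fun t : Icc a b => hQc t t.2).inter_left ?_
      have : {f : Icc a b → E | LipschitzWith K f} =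
          ⋂ s, ⋂ t, {f | dist (f s) (f t) ≤ K * dist s t} := by
        ext f
        simp only [lipschitzWith_iff_dist_le_mul, mem_ofPred_eq, mem_iInter]
      rw [this]
      refine isClosed_iInter fun s => isClosed_iInter fun t => ?_
      exact isClosed_le (by fun_prop) continuous_const
    · exact (LipschitzWith.uniformEquicontinuous _ K fun f : S => f.2.1).equicontinuous
  obtain ⟨y, hy, φ, hφ, hlim⟩ := hScomp.tendsto_subseq
    (x := g) fun n => ⟨hg n, fun t => hQu t t.2 n⟩
  have hext : (fun t => if ht : t ∈ Icc a b then y ⟨t, ht⟩ else 0) ∘ ((↑) : Icc a b → ℝ) = y := by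
    funext t
    simp only [Function.comp_apply, Subtype.coe_prop, dif_pos]
  refine ⟨φ, fun t => if ht : t ∈ Icc a b then y ⟨t, ht⟩ else 0, hφ, ?_, ?_⟩
  · rw [tendstoUniformlyOn_iff_tendstoUniformly_comp_coe, hext]
    exact (ContinuousMap.tendsto_iff_tendstoUniformly).1 hlim
  · rw [lipschitzOnWith_iff_restrict]
    exact (congrArg (LipschitzWith K) hext).mpr hy.1

/-- A bounded sequence whose distance to a ball-compact set tends to zero is relatively compact. -/
theorem exists_isCompact_of_tendsto_infDist {E : Type*} [NormedAddCommGroup E] [CompleteSpace E]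
    {S : Set E} (hS : BallCompact S) (hne : S.Nonempty) {u : ℕ → E} {R : ℝ}
    (hR : ∀ n, ‖u n‖ ≤ R) (hd : Tendsto (fun n => Metric.infDist (u n) S) atTop (𝓝 0)) :
    ∃ Q : Set E, IsCompact Q ∧ ∀ n, u n ∈ Q := by
  suffices h : TotallyBounded (range u) from
    ⟨closure (range u), h.closure.isCompact_of_isClosed isClosed_closure,
      fun n => subset_closure ⟨n, rfl⟩⟩
  have hR0 : 0 ≤ R := (norm_nonneg _).trans (hR 0)
  have hcomp := (hS (R + 1) (by positivity)).totallyBounded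
  rw [Metric.totallyBounded_iff] at hcomp ⊢
  intro e he
  obtain ⟨F, hF, hcov⟩ := hcomp (e / 2) (by positivity)
  have hpos : 0 < min (e / 2) 1 := by positivity
  obtain ⟨N, hN⟩ := eventually_atTop.1 (hd.eventually (gt_mem_nhds hpos))
  refine ⟨F ∪ u '' Iio N, hF.union ((finite_Iio N).image u), ?_⟩
  rintro _ ⟨n, rfl⟩
  rw [mem_iUnion₂]
  rcases lt_or_ge n N with hn | hn
  · exact ⟨u n, Or.inr ⟨n, hn, rfl⟩, Metric.mem_ball_self he⟩
  · obtain ⟨s, hs, hsu⟩ := (Metric.infDist_lt_iff hne).1 (hN n hn)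
    have hsR : s ∈ S ∩ Metric.closedBall 0 (R + 1) := by
      refine ⟨hs, ?_⟩
      rw [mem_closedBall_zero_iff]
      have h1 := norm_sub_norm_le s (u n)
      rw [← dist_eq_norm, dist_comm] at h1
      linarith [hR n, min_le_right (e / 2) 1]
    obtain ⟨c, hc, hsc⟩ := mem_iUnion₂.1 (hcov hsR)
    refine ⟨c, Or.inl hc, ?_⟩
    rw [Metric.mem_ball] at hsc ⊢
    linarith [dist_triangle (u n) s c, min_le_left (e / 2) 1]

end Compactness

/-! ### Passing to the limit in the pointwise inclusions -/

section Limits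

theorem map_mem_closure_convexHull_tail {E G : Type*} [NormedAddCommGroup E] [NormedSpace ℝ E]
    [NormedAddCommGroup G] [NormedSpace ℝ G] (L : E →L[ℝ] G) {u : ℕ → E} {z : E} {N : ℕ}
    (hz : z ∈ closure (convexHull ℝ (u '' Ici N))) :
    L z ∈ closure (convexHull ℝ ((fun n => L (u n)) '' Ici N)) := by
  have h1 := image_closure_subset_closure_image L.continuous (mem_image_of_mem L hz)
  have h2 := LinearMap.image_convexHull (L : E →ₗ[ℝ] G) (u '' Ici N)
  rw [image_image] at h2
  exact h2 ▸ h1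

variable {H : Type*} [NormedAddCommGroup H] [InnerProductSpace ℝ H]

theorem le_of_mem_closure_convexHull_tail {u : ℕ → H} {z : H}
    (hz : ∀ N, z ∈ closure (convexHull ℝ (u '' Ici N))) (L : H →L[ℝ] ℝ) {c : ℝ}
    (hu : ∀ᶠ n in atTop, L (u n) ≤ c) : L z ≤ c := by
  obtain ⟨N, hN⟩ := eventually_atTop.1 hu
  have hsub : closure (convexHull ℝ (u '' Ici N)) ⊆ {w | L w ≤ c} :=
    closure_minimal (convexHull_min (by rintro _ ⟨n, hn, rfl⟩; exact hN n hn)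
      (convex_halfSpace_le L.toLinearMap.isLinear c)) (isClosed_le L.continuous continuous_const)
  exact hsub (hz N)

/-- A convex-valued map that is upper semicontinuous into the weak topology is closed under limits
of convex combinations: separate the limit from the value by a half-space, which is weakly closed. -/
theorem UpperSemicontinuousToWeak.mem_of_tendsto {G : H → Set H}
    (hG : UpperSemicontinuousToWeak G) {y z : H} (hcl : IsClosed (G y)) (hcv : Convex ℝ (G y))
    {a v : ℕ → H} (ha : Tendsto a atTop (𝓝 y)) (hv : ∀ n, v n ∈ G (a n))
    (hz : ∀ N, z ∈ closure (convexHull ℝ (v '' Ici N))) : z ∈ G y := by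
  by_contra hzG
  obtain ⟨L, c, hLc, hcz⟩ := geometric_hahn_banach_closed_point hcv hcl hzG
  have hW : IsClosed {w : WeakSpace ℝ H | c ≤ L ((toWeakSpace ℝ H).symm w)} :=
    isClosed_le continuous_const (WeakBilin.eval_continuous (topDualPairing ℝ H).flip L)
  have hpre := hG _ hW
  have hy : y ∈ {x : H | ∃ w ∈ G x,
      toWeakSpace ℝ H w ∈ {w : WeakSpace ℝ H | c ≤ L ((toWeakSpace ℝ H).symm w)}}ᶜ := by
    rintro ⟨w, hw, hcw⟩
    exact absurd (hLc w hw) (not_lt.2 hcw)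
  have hev := ha.eventually (hpre.isOpen_compl.mem_nhds hy)
  refine absurd (le_of_mem_closure_convexHull_tail hz L (c := c) ?_) (not_le.2 hcz)
  filter_upwards [hev] with n hn
  by_contra hlt
  exact hn ⟨v n, hv n, by simpa using (not_le.1 hlt).le⟩

/-- Closedness of the normal cones of a Lipschitz equi-uniformly subsmooth family under limits of
convex combinations: the Fréchet normal inequality, uniform along the family, is affine in the
normal. -/
theorem EquiUniformlySubsmooth.neg_mem_clarkeNormalCone_of_tendsto {I : Set ℝ} {C : ℝ → Set H}
    (hC : EquiUniformlySubsmooth I C) {L : ℝ≥0}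
    (hlip : ∀ t ∈ I, ∀ s ∈ I, Metric.hausdorffEDist (C t) (C s) ≤ ENNReal.ofReal (L * |t - s|))
    {t : ℝ} (ht : t ∈ I) {y z : H} (hy : y ∈ C t) {s : ℕ → ℝ} (hs : ∀ j, s j ∈ I)
    (hst : Tendsto s atTop (𝓝 t)) {u ξ w : ℕ → H} {M : ℝ}
    (hξ : ∀ j, ξ j ∈ clarkeNormalCone (C (s j)) (u j)) (hξM : ∀ j, ‖ξ j‖ ≤ M)
    (hu : Tendsto u atTop (𝓝 y)) (hw : Tendsto (fun j => ξ j + w j) atTop (𝓝 0))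
    (hz : ∀ N, z ∈ closure (convexHull ℝ (w '' Ici N))) :
    -z ∈ clarkeNormalCone (C t) y := by
  refine mem_clarkeNormalCone_of_frechet hy fun ε hε => ?_
  have hM0 : 0 ≤ M := (norm_nonneg _).trans (hξM 0)
  obtain ⟨δ, hδ, hsub⟩ := hC.inner_le (M := M + 1) (by positivity) hε
  refine ⟨δ / 2, by positivity, fun u' hu' hd => ?_⟩
  -- points of `C (s j)` converging to `u'`
  have hex : ∀ j, ∃ a ∈ C (s j), dist u' a < L * |t - s j| + 1 / ((j : ℝ) + 1) := by
    intro j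
    have hpos : 0 < 1 / ((j : ℝ) + 1) := by positivity
    have h1 : Metric.infEDist u' (C (s j)) < ENNReal.ofReal (L * |t - s j| + 1 / ((j : ℝ) + 1)) :=
      (Metric.infEDist_le_hausdorffEDist_of_mem hu').trans_lt
        ((hlip t ht (s j) (hs j)).trans_lt
          ((ENNReal.ofReal_lt_ofReal_iff (by positivity)).2 (lt_add_of_pos_right _ hpos)))
    obtain ⟨a, ha, hd⟩ := Metric.infEDist_lt_iff.1 h1
    exact ⟨a, ha, by rwa [edist_dist, ENNReal.ofReal_lt_ofReal_iff (by positivity)] at hd⟩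
  choose a haC had using hex
  have ha : Tendsto a atTop (𝓝 u') := by
    rw [tendsto_iff_dist_tendsto_zero]
    simp_rw [dist_comm (a _)]
    refine squeeze_zero (fun _ => dist_nonneg) (fun j => (had j).le) ?_
    have h1 : Tendsto (fun j => (L : ℝ) * |t - s j|) atTop (𝓝 ((L : ℝ) * |t - t|)) :=
      ((hst.const_sub t).abs).const_mul _
    have h2 := h1.add (tendsto_one_div_add_atTop_nhds_zero_nat (𝕜 := ℝ))
    rwa [sub_self, abs_zero, mul_zero, zero_add] at h2
  have hau : Tendsto (fun j => a j - u j) atTop (𝓝 (u' - y)) := ha.sub hu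
  refine le_of_forall_pos_le_add fun e he => ?_
  have hrhs : Tendsto (fun j => ε * ‖a j - u j‖ + M * ‖(u' - y) - (a j - u j)‖
      + ‖ξ j + w j‖ * ‖u' - y‖) atTop (𝓝 (ε * ‖u' - y‖)) := by
    have h1 := ((hau.norm.const_mul ε).add ((hau.const_sub (u' - y)).norm.const_mul M)).add
      (hw.norm.mul_const ‖u' - y‖)
    rwa [sub_self, norm_zero, mul_zero, zero_mul, add_zero, add_zero] at h1
  have hL : ∀ v, (-(innerSL ℝ (u' - y))) v = -inner ℝ v (u' - y) := fun v => by
    rw [neg_apply, innerSL_apply_apply, real_inner_comm]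
  have hLz := le_of_mem_closure_convexHull_tail hz (-(innerSL ℝ (u' - y)))
    (c := ε * ‖u' - y‖ + e) ?_
  · rwa [hL, ← inner_neg_left] at hLz
  · have hlt : ‖u' - y‖ < δ := by linarith
    filter_upwards [hrhs.eventually (gt_mem_nhds (lt_add_of_pos_right _ he)),
      hau.norm.eventually (gt_mem_nhds hlt)] with j hj hjδ
    have h1 := hsub (s j) (hs j) (u j) (ξ j) (hξ j) ((hξM j).trans (by linarith)) (a j) (haC j)
      hjδ.le
    have h2 : inner ℝ (ξ j) ((u' - y) - (a j - u j)) ≤ M * ‖(u' - y) - (a j - u j)‖ :=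
      (real_inner_le_norm _ _).trans (by gcongr; exact hξM j)
    have h3 : -inner ℝ (ξ j + w j) (u' - y) ≤ ‖ξ j + w j‖ * ‖u' - y‖ := by
      rw [← inner_neg_left, ← norm_neg (ξ j + w j)]
      exact real_inner_le_norm _ _
    rw [inner_sub_right] at h2
    rw [inner_add_left] at h3
    rw [hL]
    linarith

end Limits

/-! ### A priori bounds for the catching-up iterates -/

section Bounds

theorem le_of_discrete_gronwall {a : ℕ → ℝ} {α β μ : ℝ} (hα : 0 ≤ α) (hβ : 0 ≤ β) (hμ : 0 ≤ μ)
    {n : ℕ} (h0 : a 0 ≤ 0) (hstep : ∀ k < n, a (k + 1) ≤ (1 + μ * α) * a k + μ * β) :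
    ∀ k ≤ n, a k ≤ k * μ * β * Real.exp (α * (k * μ)) := by
  intro k
  induction k with
  | zero => intro _; simpa using h0
  | succ k ih =>
    intro hk
    have h1 := ih (by omega)
    have h2 : (1 + μ * α) ≤ Real.exp (α * μ) := by
      have := Real.add_one_le_exp (α * μ); linarith
    have h3 : Real.exp (α * ((k + 1 : ℕ) * μ)) = Real.exp (α * μ) * Real.exp (α * (k * μ)) := by
      rw [← Real.exp_add]; push_cast; ring_nf
    have h4 : (1 : ℝ) ≤ Real.exp (α * ((k + 1 : ℕ) * μ)) := Real.one_le_exp (by positivity)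
    calc a (k + 1) ≤ (1 + μ * α) * a k + μ * β := hstep k (by omega)
      _ ≤ (1 + μ * α) * (k * μ * β * Real.exp (α * (k * μ))) + μ * β := by gcongr
      _ ≤ Real.exp (α * μ) * (k * μ * β * Real.exp (α * (k * μ))) + μ * β := by gcongr
      _ = k * μ * β * Real.exp (α * ((k + 1 : ℕ) * μ)) + μ * β * 1 := by rw [h3]; ring
      _ ≤ k * μ * β * Real.exp (α * ((k + 1 : ℕ) * μ))
          + μ * β * Real.exp (α * ((k + 1 : ℕ) * μ)) := by gcongr
      _ = _ := by push_cast; ring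

theorem node_mem_Icc {T : ℝ} (hT : 0 < T) {n k : ℕ} (hn : 1 ≤ n) (hk : k ≤ n) :
    node T n k ∈ Icc 0 T := by
  have hn' : (0 : ℝ) < n := by exact_mod_cast hn
  have hk' : (k : ℝ) ≤ n := by exact_mod_cast hk
  refine ⟨by unfold node; positivity, ?_⟩
  unfold node
  calc (k : ℝ) * (T / n) ≤ n * (T / n) := by gcongr
    _ = T := by field_simp

theorem node_succ (T : ℝ) (n k : ℕ) : node T n (k + 1) = node T n k + T / n := by
  unfold node; push_cast; ring

theorem infDist_le_infDist_add_of_hausdorffEDist_le {E : Type*} [PseudoMetricSpace E] {S S' : Set E}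
    {r : ℝ} (hr : 0 ≤ r) (h : Metric.hausdorffEDist S S' ≤ ENNReal.ofReal r) (x : E) :
    Metric.infDist x S' ≤ Metric.infDist x S + r := by
  have h1 := Metric.infDist_le_infDist_add_hausdorffDist (x := x)
    (ne_top_of_le_ne_top ENNReal.ofReal_ne_top h)
  have h2 : Metric.hausdorffDist S S' ≤ r := ENNReal.toReal_le_of_le_ofReal hr h
  linarith

variable {H : Type*} [NormedAddCommGroup H]

theorem norm_sub_le_of_mem_inexactProj {S : Set H} {ε η : ℝ} (hε : 0 ≤ ε) {q z : H}
    (hz : z ∈ inexactProj S ε η q) : ‖q - z‖ ≤ Metric.infDist q S + √ε := by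
  obtain ⟨E, -, -, -, -, hzd⟩ := hz
  have h0 : 0 ≤ Metric.infDist q S := Metric.infDist_nonneg
  refine le_of_sq_le_sq ?_ (by positivity)
  nlinarith [Real.sq_sqrt hε, Real.sqrt_nonneg ε]

theorem infDist_le_of_mem_inexactProj {S : Set H} {ε η : ℝ} {q z : H}
    (hz : z ∈ inexactProj S ε η q) : Metric.infDist z S ≤ η := by
  obtain ⟨E, -, -, hES, hzE, -⟩ := hz
  obtain ⟨s, hs, b, hb, rfl⟩ := hES hzE
  refine (Metric.infDist_le_dist_of_mem hs).trans ?_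
  rw [mem_closedBall_zero_iff] at hb
  simpa [dist_eq_norm] using hb

variable [InnerProductSpace ℝ H]

/-- The increment of the iterates at step `k` that is due to the projection. -/
noncomputable def projIncrement (T : ℝ) (f : ℝ → H → H) (n : ℕ) (p : ℕ → H) (k : ℕ) : H :=
  p (k + 1) - p k - ∫ s in (node T n k)..(node T n (k + 1)), f s (p k)

theorem norm_integral_le_of_ae_Icc {E : Type*} [NormedAddCommGroup E] [NormedSpace ℝ E] {T : ℝ}
    {g : ℝ → E} {A : ℝ}
    (hg : ∀ᵐ t ∂(volume.restrict (Icc 0 T)), ‖g t‖ ≤ A) {a b : ℝ} (ha : a ∈ Icc 0 T)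
    (hb : b ∈ Icc 0 T) : ‖∫ s in a..b, g s‖ ≤ A * |b - a| := by
  refine intervalIntegral.norm_integral_le_of_norm_le_const_ae ?_
  rw [ae_restrict_iff' measurableSet_Icc] at hg
  filter_upwards [hg] with t ht hab
  exact ht ((uIoc_subset_uIcc.trans (uIcc_subset_Icc ha hb)) hab)

namespace IsInexactCatchingUp

variable {T : ℝ} {C : ℝ → Set H} {f : ℝ → H → H} {x₀ : H} {n : ℕ} {ε η : ℝ} {p : ℕ → H}
  {x : ℝ → H}

theorem infDist_le (hx : IsInexactCatchingUp T C f x₀ n ε η p x) (hx₀ : x₀ ∈ C 0) (hη : 0 ≤ η) :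
    ∀ k ≤ n, Metric.infDist (p k) (C (node T n k)) ≤ η
  | 0, _ => by
    have : node T n 0 = 0 := by simp [node]
    rw [hx.start, this, Metric.infDist_zero_of_mem hx₀]
    exact hη
  | k + 1, hk => infDist_le_of_mem_inexactProj (hx.step k hk)

theorem norm_projIncrement_le (hx : IsInexactCatchingUp T C f x₀ n ε η p x) (hT : 0 < T)
    (hn : 1 ≤ n) (hx₀ : x₀ ∈ C 0) (hε : 0 ≤ ε) (hη : 0 ≤ η) {L : ℝ≥0}
    (hC : ∀ t ∈ Icc 0 T, ∀ s ∈ Icc 0 T,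
      Metric.hausdorffEDist (C t) (C s) ≤ ENNReal.ofReal (L * |t - s|)) {k : ℕ} (hk : k < n) :
    ‖projIncrement T f n p k‖ ≤
      ‖∫ s in (node T n k)..(node T n (k + 1)), f s (p k)‖ + η + L * (T / n) + √ε := by
  have hn' : (0 : ℝ) < n := by exact_mod_cast hn
  have h1 := norm_sub_le_of_mem_inexactProj hε (hx.step k hk)
  have h2 : Metric.infDist (p k + ∫ s in (node T n k)..(node T n (k + 1)), f s (p k))
      (C (node T n (k + 1))) ≤ Metric.infDist (p k) (C (node T n (k + 1)))
        + ‖∫ s in (node T n k)..(node T n (k + 1)), f s (p k)‖ := by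
    refine (Metric.infDist_le_infDist_add_dist (y := p k)).trans_eq ?_
    simp [dist_eq_norm]
  have h3 := infDist_le_infDist_add_of_hausdorffEDist_le (by positivity)
    (hC _ (node_mem_Icc hT hn hk.le) _ (node_mem_Icc hT hn hk)) (p k)
  have h4 : |node T n k - node T n (k + 1)| = T / n := by
    rw [node_succ, sub_add_cancel_left, abs_neg, abs_of_pos (by positivity)]
  rw [h4] at h3
  have h5 := hx.infDist_le hx₀ hη k hk.le
  have h6 : ‖projIncrement T f n p k‖ =
      ‖p k + (∫ s in (node T n k)..(node T n (k + 1)), f s (p k)) - p (k + 1)‖ := by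
    rw [← norm_neg, projIncrement]; congr 1; abel
  linarith

/-- Bounds for the iterates that depend only on the data: the increments satisfy a discrete Grönwall
inequality. -/
theorem bounds (hx : IsInexactCatchingUp T C f x₀ n ε η p x) (hT : 0 < T)
    (hn : 1 ≤ n) (hx₀ : x₀ ∈ C 0) (hε : 0 ≤ ε) (hη : 0 ≤ η) {L : ℝ≥0}
    (hC : ∀ t ∈ Icc 0 T, ∀ s ∈ Icc 0 T,
      Metric.hausdorffEDist (C t) (C s) ≤ ENNReal.ofReal (L * |t - s|))
    {h : H → ℝ} (hh0 : ∀ u, 0 ≤ h u) {L_h : ℝ≥0} (hh : LipschitzWith L_h h) {g B : ℝ} (hg : 0 ≤ g)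
    (hf : ∀ u, ∀ᵐ t ∂(volume.restrict (Icc 0 T)), ‖f t u‖ ≤ h u + g)
    (hB : 0 ≤ B) (hεB : √ε ≤ B * (T / n)) (hηB : η ≤ B * (T / n)) {A : ℝ}
    (hA : h x₀ + L_h * (T * (2 * (h x₀ + g) + 2 * B + L) * Real.exp (2 * L_h * T)) + g ≤ A) :
    ∀ k < n, (∀ᵐ t ∂(volume.restrict (Icc 0 T)), ‖f t (p k)‖ ≤ A) ∧
      ‖projIncrement T f n p k‖ ≤ (A + 2 * B + L) * (T / n) := by
  have hn' : (0 : ℝ) < n := by exact_mod_cast hn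
  have hμ : 0 < T / n := by positivity
  have hh' : ∀ u, h u ≤ h x₀ + L_h * ‖u - x₀‖ := fun u => by
    have := hh.dist_le_mul u x₀
    rw [Real.dist_eq, dist_eq_norm] at this
    linarith [le_abs_self (h u - h x₀)]
  have hint : ∀ k < n, ∀ a : ℝ, (∀ᵐ t ∂(volume.restrict (Icc 0 T)), ‖f t (p k)‖ ≤ a) →
      ‖∫ s in (node T n k)..(node T n (k + 1)), f s (p k)‖ ≤ a * (T / n) := fun k hk a ha => by
    have h1 := norm_integral_le_of_ae_Icc ha (node_mem_Icc hT hn hk.le) (node_mem_Icc hT hn hk)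
    rwa [node_succ, add_sub_cancel_left, abs_of_pos hμ, ← node_succ] at h1
  have hgr := le_of_discrete_gronwall (a := fun k => ‖p k - x₀‖) (α := 2 * L_h)
    (β := 2 * (h x₀ + g) + 2 * B + L) (μ := T / n) (n := n) (by positivity)
    (by have := hh0 x₀; positivity) hμ.le (by simp [hx.start]) (fun k hk => by
      have h1 := hint k hk _ (hf (p k))
      have h2 := hx.norm_projIncrement_le hT hn hx₀ hε hη hC hk
      have h3 : p (k + 1) - x₀ = (p k - x₀) + projIncrement T f n p k
          + ∫ s in (node T n k)..(node T n (k + 1)), f s (p k) := by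
        rw [projIncrement]; abel
      have h4 : ‖p (k + 1) - x₀‖ ≤ ‖p k - x₀‖ + ‖projIncrement T f n p k‖
          + ‖∫ s in (node T n k)..(node T n (k + 1)), f s (p k)‖ := by
        rw [h3]; exact norm_add₃_le
      have h5 : (h (p k) + g) * (T / n) ≤ (h x₀ + L_h * ‖p k - x₀‖ + g) * (T / n) := by
        gcongr; exact hh' _
      linarith)
  intro k hk
  have hfA : ∀ᵐ t ∂(volume.restrict (Icc 0 T)), ‖f t (p k)‖ ≤ A := by
    filter_upwards [hf (p k)] with t ht
    have h1 := hgr k hk.le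
    have h2 : (k : ℝ) * (T / n) ≤ T := (node_mem_Icc hT hn hk.le).2
    have h3 : ‖p k - x₀‖ ≤ T * (2 * (h x₀ + g) + 2 * B + L) * Real.exp (2 * L_h * T) := by
      have := hh0 x₀
      exact h1.trans (by gcongr)
    have h4 : L_h * ‖p k - x₀‖ ≤
        L_h * (T * (2 * (h x₀ + g) + 2 * B + L) * Real.exp (2 * L_h * T)) := by gcongr
    linarith [hh' (p k)]
  refine ⟨hfA, ?_⟩
  have h1 := hint k hk _ hfA
  have h2 := hx.norm_projIncrement_le hT hn hx₀ hε hη hC hk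
  linarith

end IsInexactCatchingUp

end Bounds

/-! ### The velocity of the interpolated curve -/

section Velocity

/-- The index `k` of the interval `]t_k^n, t_{k+1}^n]` that contains `t`; it is `0` at `t = 0`. -/
noncomputable def stepIndex (T : ℝ) (n : ℕ) (t : ℝ) : ℕ := ⌈t / (T / n)⌉₊ - 1

theorem measurable_stepIndex (T : ℝ) (n : ℕ) : Measurable (stepIndex T n) :=
  (measurable_from_nat (f := fun k : ℕ => k - 1)).comp
    (Nat.measurable_ceil.comp (measurable_id.div_const _))

theorem stepIndex_eq {T : ℝ} (hT : 0 < T) {n k : ℕ} (hn : 1 ≤ n) {t : ℝ}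
    (ht : t ∈ Ioc (node T n k) (node T n (k + 1))) : stepIndex T n t = k := by
  have hn' : (0 : ℝ) < n := by exact_mod_cast hn
  have hμ : 0 < T / n := by positivity
  have h1 : ⌈t / (T / n)⌉₊ = k + 1 := by
    rw [Nat.ceil_eq_iff (by omega)]
    refine ⟨?_, ?_⟩
    · rw [lt_div_iff₀ hμ]; simpa [node] using ht.1
    · rw [div_le_iff₀ hμ]; exact ht.2
  rw [stepIndex, h1, Nat.add_sub_cancel]

theorem mem_Ioc_stepIndex {T : ℝ} (hT : 0 < T) {n : ℕ} (hn : 1 ≤ n) {t : ℝ} (ht : 0 < t) :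
    t ∈ Ioc (node T n (stepIndex T n t)) (node T n (stepIndex T n t + 1)) := by
  have hn' : (0 : ℝ) < n := by exact_mod_cast hn
  have hμ : 0 < T / n := by positivity
  have h0 : 0 < ⌈t / (T / n)⌉₊ := Nat.ceil_pos.2 (by positivity)
  have h1 : stepIndex T n t + 1 = ⌈t / (T / n)⌉₊ := Nat.sub_add_cancel h0
  refine ⟨?_, ?_⟩
  · have h2 : stepIndex T n t < ⌈t / (T / n)⌉₊ := by omega
    rw [Nat.lt_ceil, lt_div_iff₀ hμ] at h2
    exact h2
  · rw [h1, node, ← div_le_iff₀ hμ]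
    exact Nat.le_ceil _

theorem stepIndex_lt {T : ℝ} (hT : 0 < T) {n : ℕ} (hn : 1 ≤ n) {t : ℝ} (ht : t ∈ Icc 0 T) :
    stepIndex T n t < n := by
  have hn' : (0 : ℝ) < n := by exact_mod_cast hn
  have h1 : ⌈t / (T / n)⌉₊ ≤ n := by
    rw [Nat.ceil_le, div_le_iff₀ (by positivity)]
    calc t ≤ T := ht.2
      _ = n * (T / n) := by field_simp
  unfold stepIndex
  omega

theorem abs_node_stepIndex_succ_sub_le {T : ℝ} (hT : 0 < T) {n : ℕ} (hn : 1 ≤ n) {t : ℝ}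
    (ht : 0 ≤ t) : |node T n (stepIndex T n t + 1) - t| ≤ T / n ∧
      |node T n (stepIndex T n t) - t| ≤ T / n := by
  have hn' : (0 : ℝ) < n := by exact_mod_cast hn
  have hμ : 0 < T / n := by positivity
  have h0 := node_succ T n (stepIndex T n t)
  rcases ht.eq_or_lt with rfl | ht
  · have : node T n (stepIndex T n 0) = 0 := by simp [stepIndex, node]
    rw [this] at h0 ⊢
    rw [h0]
    constructor <;> simp [abs_of_pos hμ, hμ.le]
  · have h1 := mem_Ioc_stepIndex hT hn ht
    constructor <;> rw [abs_le] <;> constructor <;> linarith [h1.1, h1.2]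

variable {H : Type*} [NormedAddCommGroup H]

/-- The perturbation part of the velocity of the interpolated curve. -/
noncomputable def driftVelocity (T : ℝ) (f : ℝ → H → H) (n : ℕ) (p : ℕ → H) (t : ℝ) : H :=
  f t (p (stepIndex T n t))

theorem aestronglyMeasurable_driftVelocity {T : ℝ} {f : ℝ → H → H} {ν : Measure ℝ}
    (hf : ∀ u, AEStronglyMeasurable (fun t => f t u) ν) (n : ℕ) (p : ℕ → H) :
    AEStronglyMeasurable (driftVelocity T f n p) ν := by
  have hms : ∀ k, MeasurableSet (stepIndex T n ⁻¹' {k}) := fun k =>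
    measurable_stepIndex T n (measurableSet_singleton k)
  have hU : (⋃ k, stepIndex T n ⁻¹' {k}) = univ := by
    ext t; simp
  rw [← Measure.restrict_univ (μ := ν), ← hU, aestronglyMeasurable_iUnion_iff]
  intro k
  refine ((hf (p k)).mono_measure Measure.restrict_le_self).congr ?_
  filter_upwards [ae_restrict_mem (hms k)] with t ht
  rw [driftVelocity, show stepIndex T n t = k from ht]

/-- The exceptional null set in the bound on `f t u` depends on `u`, but only the finitely many
iterates are inserted for `u`. -/
theorem ae_norm_driftVelocity_le {T : ℝ} (hT : 0 < T) {f : ℝ → H → H} {n : ℕ} (hn : 1 ≤ n)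
    {p : ℕ → H} {A : ℝ}
    (hA : ∀ k < n, ∀ᵐ t ∂(volume.restrict (Icc 0 T)), ‖f t (p k)‖ ≤ A) :
    ∀ᵐ t ∂(volume.restrict (Icc 0 T)), ‖driftVelocity T f n p t‖ ≤ A := by
  have h1 : ∀ᵐ t ∂(volume.restrict (Icc 0 T)), ∀ k, k < n → ‖f t (p k)‖ ≤ A := by
    rw [ae_all_iff]
    intro k
    by_cases hk : k < n
    · filter_upwards [hA k hk] with t ht _ using ht
    · exact Eventually.of_forall fun t h => absurd h hk
  filter_upwards [h1, ae_restrict_mem measurableSet_Icc] with t ht htI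
  exact ht _ (stepIndex_lt hT hn htI)

variable [InnerProductSpace ℝ H]

/-- The piecewise constant part of the velocity of the interpolated curve that is due to the
projections. -/
noncomputable def projVelocity (T : ℝ) (f : ℝ → H → H) (n : ℕ) (p : ℕ → H) (t : ℝ) : H :=
  (T / n)⁻¹ • projIncrement T f n p (stepIndex T n t)

theorem stronglyMeasurable_projVelocity (T : ℝ) (f : ℝ → H → H) (n : ℕ) (p : ℕ → H) :
    StronglyMeasurable (projVelocity T f n p) :=
  (StronglyMeasurable.of_discrete
    (f := fun k => (T / n)⁻¹ • projIncrement T f n p k)).comp_measurable (measurable_stepIndex T n)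

theorem norm_projVelocity_le {T : ℝ} (hT : 0 < T) {f : ℝ → H → H} {n : ℕ} (hn : 1 ≤ n)
    {p : ℕ → H} {V : ℝ} (hV : ∀ k < n, ‖projIncrement T f n p k‖ ≤ V * (T / n)) {t : ℝ}
    (ht : t ∈ Icc 0 T) : ‖projVelocity T f n p t‖ ≤ V := by
  have hn' : (0 : ℝ) < n := by exact_mod_cast hn
  have hμ : 0 < T / n := by positivity
  rw [projVelocity, norm_smul, norm_inv, Real.norm_of_nonneg hμ.le, inv_mul_le_iff₀ hμ, mul_comm]
  exact hV _ (stepIndex_lt hT hn ht)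

theorem intervalIntegrable_of_ae_bound_Icc {E : Type*} [NormedAddCommGroup E] {T : ℝ} {g : ℝ → E}
    {A : ℝ} (hm : AEStronglyMeasurable g (volume.restrict (Icc 0 T)))
    (hg : ∀ᵐ t ∂(volume.restrict (Icc 0 T)), ‖g t‖ ≤ A) {a b : ℝ} (ha : a ∈ Icc 0 T)
    (hb : b ∈ Icc 0 T) : IntervalIntegrable g volume a b := by
  have h1 : IntegrableOn g (Icc 0 T) := (memLp_top_of_bound hm A hg).integrable le_top
  exact (h1.mono_set (uIcc_subset_Icc ha hb)).intervalIntegrable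

/-- The interpolated curve is the primitive of its velocity. -/
theorem IsInexactCatchingUp.eq_add_integral [CompleteSpace H] {T : ℝ} {C : ℝ → Set H}
    {f : ℝ → H → H} {x₀ : H} {n : ℕ} {ε η : ℝ} {p : ℕ → H} {x : ℝ → H}
    (hx : IsInexactCatchingUp T C f x₀ n ε η p x) (hT : 0 < T) (hn : 1 ≤ n) {A V : ℝ}
    (hf : ∀ u, AEStronglyMeasurable (fun t => f t u) (volume.restrict (Icc 0 T)))
    (hA : ∀ k < n, ∀ᵐ t ∂(volume.restrict (Icc 0 T)), ‖f t (p k)‖ ≤ A)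
    (hV : ∀ k < n, ‖projIncrement T f n p k‖ ≤ V * (T / n)) :
    ∀ t ∈ Icc 0 T,
      x t = x₀ + ∫ s in (0 : ℝ)..t, (driftVelocity T f n p s + projVelocity T f n p s) := by
  have hn' : (0 : ℝ) < n := by exact_mod_cast hn
  have hμ : 0 < T / n := by positivity
  have hvint : ∀ a ∈ Icc 0 T, ∀ b ∈ Icc 0 T, IntervalIntegrable
      (fun s => driftVelocity T f n p s + projVelocity T f n p s) volume a b :=
    fun a ha b hb => (intervalIntegrable_of_ae_bound_Icc
      (aestronglyMeasurable_driftVelocity hf n p) (ae_norm_driftVelocity_le hT hn hA) ha hb).add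
      (intervalIntegrable_of_ae_bound_Icc
        (stronglyMeasurable_projVelocity T f n p).aestronglyMeasurable
        (by filter_upwards [ae_restrict_mem measurableSet_Icc] with t ht
            using norm_projVelocity_le hT hn hV ht) ha hb)
  have hpiece : ∀ k < n, ∀ t ∈ Icc (node T n k) (node T n (k + 1)),
      ∫ s in (node T n k)..t, (driftVelocity T f n p s + projVelocity T f n p s) =
        ((t - node T n k) / (T / n)) • projIncrement T f n p k
          + ∫ s in (node T n k)..t, f s (p k) := by
    intro k hk t ht
    have hk0 := node_mem_Icc hT hn hk.le
    have ht0 : t ∈ Icc 0 T := ⟨hk0.1.trans ht.1, ht.2.trans (node_mem_Icc hT hn hk).2⟩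
    have h1 : ∫ s in (node T n k)..t, (driftVelocity T f n p s + projVelocity T f n p s) =
        ∫ s in (node T n k)..t, (f s (p k) + (T / n)⁻¹ • projIncrement T f n p k) := by
      refine intervalIntegral.integral_congr_ae (Eventually.of_forall fun s hs => ?_)
      rw [uIoc_of_le ht.1] at hs
      simp only [driftVelocity, projVelocity, stepIndex_eq hT hn ⟨hs.1, hs.2.trans ht.2⟩]
    rw [h1, intervalIntegral.integral_add
      (intervalIntegrable_of_ae_bound_Icc (hf (p k)) (hA k hk) hk0 ht0) intervalIntegrable_const,
      intervalIntegral.integral_const, smul_smul, add_comm,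
      div_eq_mul_inv (t - node T n k)]
  have hnode : ∀ k ≤ n, p k = x₀ +
      ∫ s in (0 : ℝ)..(node T n k), (driftVelocity T f n p s + projVelocity T f n p s) := by
    intro k
    induction k with
    | zero => intro _; simp [node, hx.start]
    | succ k ih =>
      intro hk
      have hle : node T n k ≤ node T n (k + 1) := by rw [node_succ]; linarith
      rw [← intervalIntegral.integral_add_adjacent_intervals
        (hvint 0 ⟨le_rfl, hT.le⟩ _ (node_mem_Icc hT hn (by omega : k ≤ n)))
        (hvint _ (node_mem_Icc hT hn (by omega : k ≤ n)) _ (node_mem_Icc hT hn hk)),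
        hpiece k hk _ ⟨hle, le_rfl⟩, ← add_assoc, ← ih (by omega)]
      have h1 : (node T n (k + 1) - node T n k) / (T / n) = 1 := by
        rw [node_succ, add_sub_cancel_left, div_self hμ.ne']
      rw [h1, one_smul, projIncrement]
      abel
  intro t ht
  rcases ht.1.eq_or_lt with rfl | ht0
  · simp [hx.curve_zero]
  · have h1 := mem_Ioc_stepIndex hT hn ht0
    have h2 := stepIndex_lt hT hn ht
    rw [hx.curve _ h2 t h1, ← intervalIntegral.integral_add_adjacent_intervals
        (hvint 0 ⟨le_rfl, hT.le⟩ _ (node_mem_Icc hT hn h2.le))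
        (hvint _ (node_mem_Icc hT hn h2.le) _ ht), hpiece _ h2 t ⟨h1.1.le, h1.2⟩,
        ← add_assoc x₀, ← hnode _ h2.le, projIncrement, add_assoc]

/-- The interpolated curve passes through the iterates. -/
theorem IsInexactCatchingUp.apply_node {T : ℝ} (hT : 0 < T) {C : ℝ → Set H}
    {f : ℝ → H → H} {x₀ : H} {n : ℕ} {ε η : ℝ} {p : ℕ → H} {x : ℝ → H}
    (hx : IsInexactCatchingUp T C f x₀ n ε η p x) (hn : 1 ≤ n) :
    ∀ k ≤ n, x (node T n k) = p k
  | 0, _ => by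
    have : node T n 0 = 0 := by simp [node]
    rw [this, hx.curve_zero, hx.start]
  | k + 1, hk => by
    have hn' : (0 : ℝ) < n := by exact_mod_cast hn
    have hμ : 0 < T / n := by positivity
    have h1 : (node T n (k + 1) - node T n k) / (T / n) = 1 := by
      rw [node_succ, add_sub_cancel_left, div_self hμ.ne']
    rw [hx.curve k hk _ ⟨by rw [node_succ]; linarith, le_rfl⟩, h1, one_smul]
    abel

end Velocity

/-! ### Limits of curves and of their velocities -/

section CurveLimits

theorem lipschitzOnWith_of_eq_add_integral {E : Type*} [NormedAddCommGroup E] [NormedSpace ℝ E]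
    {T M : ℝ} (hT : 0 ≤ T) {x g : ℝ → E} {x₀ : E}
    (hm : AEStronglyMeasurable g (volume.restrict (Icc 0 T)))
    (hg : ∀ᵐ t ∂(volume.restrict (Icc 0 T)), ‖g t‖ ≤ M)
    (hx : ∀ t ∈ Icc 0 T, x t = x₀ + ∫ s in (0 : ℝ)..t, g s) :
    LipschitzOnWith M.toNNReal x (Icc 0 T) := by
  refine LipschitzOnWith.of_dist_le_mul fun s hs t ht => ?_
  have h0 : (0 : ℝ) ∈ Icc 0 T := ⟨le_rfl, hT⟩
  rw [dist_eq_norm, hx s hs, hx t ht, add_sub_add_left_eq_sub,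
    intervalIntegral.integral_interval_sub_left (intervalIntegrable_of_ae_bound_Icc hm hg h0 hs)
      (intervalIntegrable_of_ae_bound_Icc hm hg h0 ht)]
  refine (norm_integral_le_of_ae_Icc hg ht hs).trans ?_
  rw [Real.dist_eq]
  gcongr
  exact Real.le_coe_toNNReal M

variable {H : Type*} [NormedAddCommGroup H] [InnerProductSpace ℝ H] [CompleteSpace H]

/-- The limit of curves whose velocities `a j + b j` are bounded has a velocity `a' + b'`, where
`a'` and `b'` almost everywhere are limits of convex combinations of the tails of `a` and `b`. The
two sequences are handled together, as one sequence of pairs, so that the same combinations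
serve both. -/
theorem exists_velocity_of_tendsto {T A V : ℝ} (hT : 0 ≤ T) {a b : ℕ → ℝ → H}
    (ham : ∀ j, AEStronglyMeasurable (a j) (volume.restrict (Icc 0 T)))
    (hbm : ∀ j, AEStronglyMeasurable (b j) (volume.restrict (Icc 0 T)))
    (ha : ∀ j, ∀ᵐ t ∂(volume.restrict (Icc 0 T)), ‖a j t‖ ≤ A)
    (hb : ∀ j, ∀ᵐ t ∂(volume.restrict (Icc 0 T)), ‖b j t‖ ≤ V)
    {x : ℕ → ℝ → H} {y : ℝ → H} {x₀ : H}
    (hx : ∀ j, ∀ t ∈ Icc 0 T, x j t = x₀ + ∫ s in (0 : ℝ)..t, (a j s + b j s))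
    (hy : ∀ t ∈ Icc 0 T, Tendsto (fun j => x j t) atTop (𝓝 (y t))) :
    ∃ a' b' : ℝ → H, IntervalIntegrable (fun t => a' t + b' t) volume 0 T ∧
      (∀ t ∈ Icc 0 T, y t = x₀ + ∫ s in (0 : ℝ)..t, (a' s + b' s)) ∧
      ∀ᵐ t ∂(volume.restrict (Icc 0 T)), ∀ N,
        a' t ∈ closure (convexHull ℝ ((fun j => a j t) '' Ici N)) ∧
        b' t ∈ closure (convexHull ℝ ((fun j => b j t) '' Ici N)) := by
  set u : ℕ → ℝ → WithLp 2 (H × H) := fun j t => WithLp.toLp 2 (a j t, b j t) with hu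
  have hum : ∀ j, AEStronglyMeasurable (u j) (volume.restrict (Icc 0 T)) := fun j =>
    (WithLp.prod_continuous_toLp 2 H H).comp_aestronglyMeasurable ((ham j).prodMk (hbm j))
  have hub : ∀ j, ∀ᵐ t ∂(volume.restrict (Icc 0 T)), ‖u j t‖ ≤ √(A ^ 2 + V ^ 2) := by
    intro j
    filter_upwards [ha j, hb j] with t h1 h2
    apply Real.le_sqrt_of_sq_le
    rw [WithLp.prod_norm_sq_eq_of_L2]
    exact add_le_add (by gcongr; exact h1) (by gcongr; exact h2)
  obtain ⟨v, hvint, hvconv, hvlim⟩ := exists_mem_closure_convexHull_tail hum hub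
  set π₁ : WithLp 2 (H × H) →L[ℝ] H := WithLp.fstL 2 ℝ H H
  set π₂ : WithLp 2 (H × H) →L[ℝ] H := WithLp.sndL 2 ℝ H H
  set σ : WithLp 2 (H × H) →L[ℝ] H := π₁ + π₂ with hσ
  have hσv : ∀ z, σ z = π₁ z + π₂ z := fun z => by rw [hσ, add_apply]
  have hσu : ∀ j s, σ (u j s) = a j s + b j s := fun j s => hσv _
  have hσint : IntegrableOn (fun t => σ (v t)) (Icc 0 T) := σ.integrable_comp hvint
  refine ⟨fun t => π₁ (v t), fun t => π₂ (v t), ?_, ?_, ?_⟩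
  · simp only [hσv] at hσint
    exact (intervalIntegrable_iff_integrableOn_Icc_of_le hT).2 hσint
  · intro t ht
    have hsub : Ioc 0 t ⊆ Icc 0 T := fun s hs => ⟨hs.1.le, hs.2.trans ht.2⟩
    have hres : ∀ g : ℝ → H, ∫ s in (0 : ℝ)..t, g s =
        ∫ s in Ioc 0 t, g s ∂(volume.restrict (Icc 0 T)) := fun g => by
      rw [intervalIntegral.integral_of_le ht.1, Measure.restrict_restrict measurableSet_Ioc,
        inter_eq_left.2 hsub]
    have hcomm : ∀ g : ℝ → WithLp 2 (H × H), Integrable g (volume.restrict (Icc 0 T)) →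
        ∫ s in (0 : ℝ)..t, σ (g s) = σ (∫ s in Ioc 0 t, g s ∂(volume.restrict (Icc 0 T))) :=
      fun g hg => by rw [hres, σ.integral_comp_comm hg.restrict]
    have huint : ∀ j, Integrable (u j) (volume.restrict (Icc 0 T)) := fun j =>
      (memLp_top_of_bound (hum j) _ (hub j)).integrable le_top
    refine (sub_eq_iff_eq_add'.1 ?_)
    refine ext_inner_left ℝ fun c => ?_
    have h1 := hvlim (Ioc 0 t) measurableSet_Ioc ((innerSL ℝ c).comp σ) (inner ℝ c (y t - x₀)) (by
      have h2 : Tendsto (fun j => inner ℝ c (x j t - x₀)) atTop (𝓝 (inner ℝ c (y t - x₀))) :=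
        tendsto_const_nhds.inner ((hy t ht).sub_const x₀)
      refine h2.congr fun j => ?_
      rw [ContinuousLinearMap.comp_apply, ← hcomm _ (huint j), innerSL_apply_apply, hx j t ht,
        add_sub_cancel_left]
      simp only [hσu])
    rw [ContinuousLinearMap.comp_apply, ← hcomm _ hvint, innerSL_apply_apply] at h1
    simp only [hσv] at h1
    exact h1.symm
  · filter_upwards [hvconv] with t ht N
    have hπ₁ : ∀ j, π₁ (u j t) = a j t := fun j => rfl
    have hπ₂ : ∀ j, π₂ (u j t) = b j t := fun j => rfl
    have h1 := map_mem_closure_convexHull_tail π₁ (ht N)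
    have h2 := map_mem_closure_convexHull_tail π₂ (ht N)
    simp only [hπ₁] at h1
    simp only [hπ₂] at h2
    exact ⟨h1, h2⟩

end CurveLimits

/-! ### Convergence of the algorithm -/

section Convergence

variable {H : Type*} [NormedAddCommGroup H]

/-- The norm of an almost minimal selection is controlled by the bound on the minimal norm. -/
theorem norm_le_of_mem_approxProj {S : Set H} {γ b : ℝ} (hγ : 0 ≤ γ) (hb : Metric.infDist 0 S ≤ b)
    {z : H} (hz : z ∈ approxProj S γ 0) : ‖z‖ ≤ b + √γ := by
  have h0 : 0 ≤ Metric.infDist (0 : H) S := Metric.infDist_nonneg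
  have hb0 : 0 ≤ b := h0.trans hb
  have h1 := hz.2
  rw [zero_sub, norm_neg] at h1
  refine le_of_sq_le_sq ?_ (by positivity)
  nlinarith [Real.sq_sqrt hγ, Real.sqrt_nonneg γ]

variable [InnerProductSpace ℝ H]

/-- Bounds for the two parts of the velocities, uniform in the number of steps: the convergent
tolerance ratios are bounded. -/
theorem exists_uniform_bounds {T : ℝ} (hT : 0 < T) {C : ℝ → Set H} {L : ℝ≥0}
    (hC : ∀ t ∈ Icc 0 T, ∀ s ∈ Icc 0 T,
      Metric.hausdorffEDist (C t) (C s) ≤ ENNReal.ofReal (L * |t - s|))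
    {h : H → ℝ} (hh0 : ∀ u, 0 ≤ h u) {L_h : ℝ≥0} (hh : LipschitzWith L_h h) {g : ℝ} (hg : 0 ≤ g)
    {f : ℝ → H → H} (hf : ∀ u, ∀ᵐ t ∂(volume.restrict (Icc 0 T)), ‖f t u‖ ≤ h u + g)
    {x₀ : H} (hx₀ : x₀ ∈ C 0) {ε η : ℕ → ℝ} (hε0 : ∀ n, 1 ≤ n → 0 < ε n)
    (hη0 : ∀ n, 1 ≤ n → 0 < η n)
    (hε : Tendsto (fun n : ℕ => ε n / (T / n) ^ 2) atTop (𝓝 0))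
    (hη : Tendsto (fun n : ℕ => η n / (T / n)) atTop (𝓝 0))
    {p : ℕ → ℕ → H} {x : ℕ → ℝ → H}
    (hx : ∀ n, 1 ≤ n → IsInexactCatchingUp T C f x₀ n (ε n) (η n) (p n) (x n)) :
    ∃ A V : ℝ, 0 ≤ A ∧ 0 ≤ V ∧ ∀ n, 1 ≤ n → ∀ k < n,
      (∀ᵐ t ∂(volume.restrict (Icc 0 T)), ‖f t (p n k)‖ ≤ A) ∧
      ‖projIncrement T f n (p n) k‖ ≤ V * (T / n) := by
  obtain ⟨b₁, hb₁⟩ := hε.bddAbove_range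
  obtain ⟨b₂, hb₂⟩ := hη.bddAbove_range
  set B : ℝ := √(max b₁ 0) + max b₂ 0 with hB
  have hB0 : 0 ≤ B := by positivity
  have hx₀' := hh0 x₀
  set A : ℝ := h x₀ + L_h * (T * (2 * (h x₀ + g) + 2 * B + L) * Real.exp (2 * L_h * T)) + g
    with hA
  refine ⟨A, A + 2 * B + L, by positivity, by positivity, fun n hn => ?_⟩
  have hn' : (0 : ℝ) < n := by exact_mod_cast hn
  have hμ : 0 < T / n := by positivity
  refine (hx n hn).bounds hT hn hx₀ (hε0 n hn).le (hη0 n hn).le hC hh0 hh hg hf hB0 ?_ ?_ le_rfl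
  · have h1 : ε n / (T / n) ^ 2 ≤ b₁ := hb₁ ⟨n, rfl⟩
    rw [div_le_iff₀ (by positivity)] at h1
    calc √(ε n) ≤ √(max b₁ 0 * (T / n) ^ 2) := by
          refine Real.sqrt_le_sqrt (h1.trans ?_)
          gcongr
          exact le_max_left _ _
      _ = √(max b₁ 0) * (T / n) := by
          rw [Real.sqrt_mul (le_max_right _ _), Real.sqrt_sq hμ.le]
      _ ≤ B * (T / n) := by
          gcongr
          exact le_add_of_nonneg_right (le_max_right _ _)
  · have h1 : η n / (T / n) ≤ b₂ := hb₂ ⟨n, rfl⟩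
    rw [div_le_iff₀ hμ] at h1
    refine h1.trans ?_
    gcongr
    exact (le_max_left _ _).trans (le_add_of_nonneg_left (Real.sqrt_nonneg _))

/-- The projection part of the velocity is, up to a sign and a vanishing error, an exact normal at
a point close to the iterate. Dividing by the step length `T / n` is what requires
`ε = o((T / n)²)` and `η = o(T / n)`. -/
theorem IsInexactCatchingUp.exists_normal_near {T : ℝ} (hT : 0 < T) {C : ℝ → Set H}
    {f : ℝ → H → H} {x₀ : H} {n : ℕ} {ε η : ℝ} {p : ℕ → H} {x : ℝ → H}
    (hx : IsInexactCatchingUp T C f x₀ n ε η p x) (hn : 1 ≤ n) (hη : 0 ≤ η)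
    (hC : ∀ t ∈ Icc 0 T, BallCompact (C t)) {V : ℝ}
    (hV : ∀ k < n, ‖projIncrement T f n p k‖ ≤ V * (T / n)) {r : ℝ}
    (hr : r = 2 * √(ε / (T / n) ^ 2 + 2 * (η / (T / n)) * V + (η / (T / n)) ^ 2) + η / (T / n))
    {t : ℝ} (ht : t ∈ Icc 0 T) :
    ∃ u ξ : H, ξ ∈ clarkeNormalCone (C (node T n (stepIndex T n t + 1))) u ∧
      ‖u - p (stepIndex T n t + 1)‖ ≤ r * (T / n) ∧ ‖ξ + projVelocity T f n p t‖ ≤ r := by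
  have hn' : (0 : ℝ) < n := by exact_mod_cast hn
  set μ : ℝ := T / n with hμdef
  have hμ : 0 < μ := by positivity
  have hk := stepIndex_lt hT hn ht
  set k := stepIndex T n t with hkdef
  obtain ⟨u, ξ, hξ, hu, hξ'⟩ := exists_normal_near_of_mem_inexactProj
    (hC _ (node_mem_Icc hT hn hk)) (hx.step k hk)
  set q : H := p k + ∫ s in (node T n k)..(node T n (k + 1)), f s (p k) with hq
  have hqz : q - p (k + 1) = -projIncrement T f n p k := by
    rw [hq, projIncrement]; abel
  have hqn : ‖q - p (k + 1)‖ ≤ V * μ := by rw [hqz, norm_neg]; exact hV k hk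
  set S : ℝ := √(ε / μ ^ 2 + 2 * (η / μ) * V + (η / μ) ^ 2) with hS
  have hsqrt : √(ε + 2 * η * ‖q - p (k + 1)‖ + η ^ 2) ≤ S * μ := by
    have h1 : S * μ = √((ε / μ ^ 2 + 2 * (η / μ) * V + (η / μ) ^ 2) * μ ^ 2) := by
      rw [Real.sqrt_mul' _ (by positivity), Real.sqrt_sq hμ.le]
    have h2 : (ε / μ ^ 2 + 2 * (η / μ) * V + (η / μ) ^ 2) * μ ^ 2
        = ε + 2 * η * (V * μ) + η ^ 2 := by
      field_simp
    rw [h1, h2]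
    apply Real.sqrt_le_sqrt
    gcongr
  have hS0 : 0 ≤ S := Real.sqrt_nonneg _
  have hrμ : r * μ = 2 * (S * μ) + η := by
    rw [hr, add_mul, div_mul_cancel₀ _ hμ.ne', mul_assoc]
  refine ⟨u, μ⁻¹ • ξ, smul_mem_clarkeNormalCone hξ (by positivity), ?_, ?_⟩
  · have : 0 ≤ S * μ := by positivity
    linarith
  · have h1 : μ⁻¹ • ξ + projVelocity T f n p t = μ⁻¹ • (ξ - (q - p (k + 1))) := by
      rw [hqz, sub_neg_eq_add, smul_add, projVelocity]
    rw [h1, norm_smul, Real.norm_of_nonneg (by positivity), inv_mul_le_iff₀ hμ, mul_comm μ, hrμ]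
    linarith

theorem IsInexactCatchingUp.dist_apply_le {T : ℝ} (hT : 0 < T) {C : ℝ → Set H}
    {f : ℝ → H → H} {x₀ : H} {n : ℕ} {ε η : ℝ} {p : ℕ → H} {x : ℝ → H}
    (hx : IsInexactCatchingUp T C f x₀ n ε η p x) (hn : 1 ≤ n) {K : ℝ≥0}
    (hK : LipschitzOnWith K x (Icc 0 T)) {t : ℝ} (ht : t ∈ Icc 0 T) :
    dist (p (stepIndex T n t + 1)) (x t) ≤ K * (T / n) ∧
      dist (p (stepIndex T n t)) (x t) ≤ K * (T / n) := by
  have hk := stepIndex_lt hT hn ht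
  have hnode := abs_node_stepIndex_succ_sub_le hT hn ht.1
  have hap := hx.apply_node hT hn
  rw [← hap _ hk, ← hap _ hk.le]
  refine ⟨(hK.dist_le_mul _ (node_mem_Icc hT hn hk) _ ht).trans ?_,
    (hK.dist_le_mul _ (node_mem_Icc hT hn hk.le) _ ht).trans ?_⟩
  · rw [Real.dist_eq]; gcongr; exact hnode.1
  · rw [Real.dist_eq]; gcongr; exact hnode.2

theorem IsInexactCatchingUp.infDist_apply_le {T : ℝ} (hT : 0 < T) {C : ℝ → Set H}
    {f : ℝ → H → H} {x₀ : H} {n : ℕ} {ε η : ℝ} {p : ℕ → H} {x : ℝ → H}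
    (hx : IsInexactCatchingUp T C f x₀ n ε η p x) (hn : 1 ≤ n) (hx₀ : x₀ ∈ C 0) (hη : 0 ≤ η)
    {L : ℝ≥0} (hC : ∀ t ∈ Icc 0 T, ∀ s ∈ Icc 0 T,
      Metric.hausdorffEDist (C t) (C s) ≤ ENNReal.ofReal (L * |t - s|)) {K : ℝ≥0}
    (hK : LipschitzOnWith K x (Icc 0 T)) {t : ℝ} (ht : t ∈ Icc 0 T) :
    Metric.infDist (x t) (C t) ≤ (η / (T / n) + L + K) * (T / n) := by
  have hn' : (0 : ℝ) < n := by exact_mod_cast hn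
  have hμ : 0 < T / n := by positivity
  have hk := stepIndex_lt hT hn ht
  set k := stepIndex T n t + 1 with hkdef
  have h1 := hx.infDist_le hx₀ hη k hk
  have h2 := infDist_le_infDist_add_of_hausdorffEDist_le (by positivity)
    (hC _ (node_mem_Icc hT hn hk) t ht) (p k)
  have h3 : (L : ℝ) * |node T n k - t| ≤ L * (T / n) := by
    gcongr
    exact (abs_node_stepIndex_succ_sub_le hT hn ht.1).1
  have h4 := (hx.dist_apply_le hT hn hK ht).1
  have h5 := Metric.infDist_le_infDist_add_dist (s := C t) (x := x t) (y := p k)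
  rw [dist_comm] at h5
  rw [add_mul, add_mul, div_mul_cancel₀ _ hμ.ne']
  linarith

end Convergence

end SweepingProcess

/-! ### The convergence theorem -/

open SweepingProcess

theorem mainTheorem2 {H : Type*} [NormedAddCommGroup H] [InnerProductSpace ℝ H] [CompleteSpace H]
    (T : ℝ) (hT : 0 < T)
    -- the moving set
    (C : ℝ → Set H)
    (hC_nonempty : ∀ t ∈ Icc 0 T, (C t).Nonempty)
    (hC_closed : ∀ t ∈ Icc 0 T, IsClosed (C t))
    (L_C : ℝ≥0)
    (hC_lip : ∀ t ∈ Icc 0 T, ∀ s ∈ Icc 0 T,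
      Metric.hausdorffEDist (C t) (C s) ≤ ENNReal.ofReal (L_C * |t - s|))
    (hC_subsmooth : SweepingProcess.EquiUniformlySubsmooth (Icc 0 T) C)
    (hC_compact : ∀ t ∈ Icc 0 T, SweepingProcess.BallCompact (C t))
    -- the perturbation
    (F : ℝ → H → Set H)
    (hF_nonempty : ∀ t ∈ Icc 0 T, ∀ x, (F t x).Nonempty)
    (hF_closed : ∀ t ∈ Icc 0 T, ∀ x, IsClosed (F t x))
    (hF_convex : ∀ t ∈ Icc 0 T, ∀ x, Convex ℝ (F t x))
    (hF_usc : ∀ t ∈ Icc 0 T, SweepingProcess.UpperSemicontinuousToWeak (F t))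
    (h : H → ℝ) (hh_nonneg : ∀ x, 0 ≤ h x) (L_h : ℝ≥0) (hh_lip : LipschitzWith L_h h)
    (hF_bound : ∀ x, ∀ᵐ t ∂(volume.restrict (Icc 0 T)), Metric.infDist 0 (F t x) ≤ h x)
    -- the measurable selection of almost minimal norm
    (γ : ℝ) (hγ : 0 < γ) (f : ℝ → H → H)
    (hf_sel : ∀ t ∈ Icc 0 T, ∀ x, f t x ∈ SweepingProcess.approxProj (F t x) γ 0)
    (hf_meas : ∀ x, AEStronglyMeasurable (fun t => f t x) (volume.restrict (Icc 0 T)))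
    -- the algorithm
    (x₀ : H) (hx₀ : x₀ ∈ C 0)
    (ε η : ℕ → ℝ) (hε_pos : ∀ n, 1 ≤ n → 0 < ε n) (hη_pos : ∀ n, 1 ≤ n → 0 < η n)
    (hε : Tendsto (fun n : ℕ => ε n / (T / n) ^ 2) atTop (𝓝 0))
    (hη : Tendsto (fun n : ℕ => η n / (T / n)) atTop (𝓝 0))
    (p : ℕ → ℕ → H) (x : ℕ → ℝ → H)
    (hx : ∀ n, 1 ≤ n →
      SweepingProcess.IsInexactCatchingUp T C f x₀ n (ε n) (η n) (p n) (x n)) :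
    ∃ (φ : ℕ → ℕ) (y : ℝ → H), StrictMono φ ∧
      TendstoUniformlyOn (fun j => x (φ j)) y atTop (Icc 0 T) ∧
      SweepingProcess.IsLipschitzSolution T C F x₀ y := by
  have hT0 : (0 : ℝ) ∈ Icc 0 T := ⟨le_rfl, hT.le⟩
  have hfb : ∀ u, ∀ᵐ t ∂(volume.restrict (Icc 0 T)), ‖f t u‖ ≤ h u + √γ := fun u => by
    filter_upwards [hF_bound u, ae_restrict_mem measurableSet_Icc] with t ht htI
    exact norm_le_of_mem_approxProj hγ.le ht (hf_sel t htI u)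
  obtain ⟨A, V, hA0, hV0, hAV⟩ := exists_uniform_bounds hT hC_lip hh_nonneg hh_lip
    (Real.sqrt_nonneg γ) hfb hx₀ hε_pos hη_pos hε hη hx
  have ham : ∀ n, AEStronglyMeasurable (driftVelocity T f n (p n))
      (volume.restrict (Icc 0 T)) := fun n =>
    aestronglyMeasurable_driftVelocity hf_meas n (p n)
  have hbm : ∀ n, AEStronglyMeasurable (projVelocity T f n (p n))
      (volume.restrict (Icc 0 T)) := fun n =>
    (stronglyMeasurable_projVelocity T f n (p n)).aestronglyMeasurable
  have ha : ∀ n, 1 ≤ n → ∀ᵐ t ∂(volume.restrict (Icc 0 T)),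
      ‖driftVelocity T f n (p n) t‖ ≤ A := fun n hn =>
    ae_norm_driftVelocity_le hT hn fun k hk => (hAV n hn k hk).1
  have hb' : ∀ n, 1 ≤ n → ∀ t ∈ Icc 0 T,
      ‖projVelocity T f n (p n) t‖ ≤ V := fun n hn t ht =>
    norm_projVelocity_le hT hn (fun k hk => (hAV n hn k hk).2) ht
  have hb : ∀ n, 1 ≤ n → ∀ᵐ t ∂(volume.restrict (Icc 0 T)),
      ‖projVelocity T f n (p n) t‖ ≤ V := fun n hn => by
    filter_upwards [ae_restrict_mem measurableSet_Icc] with t ht using hb' n hn t ht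
  have hrep : ∀ n, 1 ≤ n → ∀ t ∈ Icc 0 T, x n t = x₀ + ∫ s in (0 : ℝ)..t,
      (driftVelocity T f n (p n) s + projVelocity T f n (p n) s) :=
    fun n hn => (hx n hn).eq_add_integral hT hn hf_meas (fun k hk => (hAV n hn k hk).1)
      fun k hk => (hAV n hn k hk).2
  set K : ℝ≥0 := (A + V).toNNReal with hK
  have hlip : ∀ n, 1 ≤ n → LipschitzOnWith K (x n) (Icc 0 T) := fun n hn =>
    lipschitzOnWith_of_eq_add_integral hT.le ((ham n).add (hbm n)) (by
      filter_upwards [ha n hn, hb n hn] with t h1 h2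
      exact (norm_add_le _ _).trans (add_le_add h1 h2)) (hrep n hn)
  have hμ : Tendsto (fun n : ℕ => T / n) atTop (𝓝 0) := tendsto_const_div_atTop_nhds_zero_nat T
  have hinf : ∀ t ∈ Icc 0 T, ∀ n, 1 ≤ n →
      Metric.infDist (x n t) (C t) ≤ (η n / (T / n) + L_C + K) * (T / n) := fun t ht n hn =>
    (hx n hn).infDist_apply_le hT hn hx₀ (hη_pos n hn).le hC_lip (hlip n hn) ht
  have hinf0 : Tendsto (fun n : ℕ => (η n / (T / n) + L_C + K) * (T / n)) atTop (𝓝 0) := by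
    have := ((hη.add_const (L_C : ℝ)).add_const (K : ℝ)).mul hμ
    rwa [mul_zero] at this
  obtain ⟨ψ, y, hψ, hψy, hylip⟩ :=
    exists_subseq_tendstoUniformlyOn_of_lipschitzOnWith (u := fun n => x (n + 1))
      (fun n => hlip (n + 1) (by omega)) (fun t ht => by
        refine exists_isCompact_of_tendsto_infDist (hC_compact t ht)
          (hC_nonempty t ht) (R := ‖x₀‖ + K * T) (fun n => ?_) ?_
        · have h1 := (hlip (n + 1) (by omega)).dist_le_mul t ht 0 hT0
          rw [(hx (n + 1) (by omega)).curve_zero, dist_eq_norm, dist_zero_right,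
            Real.norm_of_nonneg ht.1] at h1
          have h2 : (K : ℝ) * t ≤ K * T := by gcongr; exact ht.2
          have h3 := norm_sub_norm_le (x (n + 1) t) x₀
          linarith
        · exact squeeze_zero (fun _ => Metric.infDist_nonneg) (fun n => hinf t ht (n + 1) (by omega))
            (hinf0.comp (tendsto_add_atTop_nat 1)))
  -- the shift by one discards the index `0`, for which the algorithm is not defined
  set φ : ℕ → ℕ := fun j => ψ j + 1 with hφdef
  have hφ : StrictMono φ := fun i j hij => Nat.add_lt_add_right (hψ hij) 1
  have hφ1 : ∀ j, 1 ≤ φ j := fun j => Nat.le_add_left 1 _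
  have hφt : Tendsto φ atTop atTop := hφ.tendsto_atTop
  have hy : ∀ t ∈ Icc 0 T, Tendsto (fun j => x (φ j) t) atTop (𝓝 (y t)) := fun t ht =>
    hψy.tendsto_at ht
  have hy0 : y 0 = x₀ := by
    refine tendsto_nhds_unique (hy 0 hT0) (tendsto_const_nhds.congr fun j => ?_)
    exact ((hx (φ j) (hφ1 j)).curve_zero).symm
  have hyC : ∀ t ∈ Icc 0 T, y t ∈ C t := fun t ht => by
    rw [(hC_closed t ht).mem_iff_infDist_zero (hC_nonempty t ht)]
    have h1 := ((Metric.continuous_infDist_pt (C t)).tendsto (y t)).comp (hy t ht)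
    exact tendsto_nhds_unique h1 (squeeze_zero (fun _ => Metric.infDist_nonneg)
      (fun j => hinf t ht (φ j) (hφ1 j)) (hinf0.comp hφt))
  obtain ⟨a', b', hint, hyrep, hconv⟩ := exists_velocity_of_tendsto hT.le
    (fun j => ham (φ j)) (fun j => hbm (φ j)) (fun j => ha (φ j) (hφ1 j))
    (fun j => hb (φ j) (hφ1 j)) (fun j => hrep (φ j) (hφ1 j)) hy
  refine ⟨φ, y, hφ, hψy, ⟨K, hylip⟩, hy0, ?_⟩
  have hderiv := hint.ae_hasDerivAt_integral
  rw [uIcc_of_le hT.le] at hderiv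
  filter_upwards [hconv, ae_restrict_mem measurableSet_Icc, ae_restrict_of_ae hderiv]
    with t htconv htI htd
  refine ⟨a' t + b' t, ?_, ?_⟩
  · exact ((htd htI 0 hT0).const_add x₀).hasDerivWithinAt.congr hyrep (hyrep t htI)
  have hiter : ∀ k : ℕ → ℕ,
      (∀ j, dist (p (φ j) (k j)) (x (φ j) t) ≤ K * (T / (φ j : ℕ))) →
      Tendsto (fun j => p (φ j) (k j)) atTop (𝓝 (y t)) := fun k hk => by
    have h1 : Tendsto (fun j => dist (p (φ j) (k j)) (x (φ j) t)) atTop (𝓝 0) := by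
      refine squeeze_zero (fun _ => dist_nonneg) hk ?_
      have := (hμ.comp hφt).const_mul (K : ℝ)
      rwa [mul_zero] at this
    exact (tendsto_iff_of_dist h1).2 (hy t htI)
  refine ⟨b' t, ?_, a' t, ?_, add_comm _ _⟩
  · -- the projection part of the velocity is a limit of exact normals at nearby points
    rw [Set.mem_neg]
    set r : ℕ → ℝ := fun n => 2 * √(ε n / (T / n) ^ 2 + 2 * (η n / (T / n)) * V
      + (η n / (T / n)) ^ 2) + η n / (T / n) with hr
    have hr0 : Tendsto r atTop (𝓝 0) := by
      have h1 := (((hε.add ((hη.const_mul 2).mul_const V)).add (hη.pow 2)).sqrt.const_mul 2).add hη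
      simpa using h1
    obtain ⟨R, hR⟩ := hr0.bddAbove_range
    choose u ξ hξ hu hξb using fun j => (hx (φ j) (hφ1 j)).exists_normal_near hT (hφ1 j)
      (hη_pos _ (hφ1 j)).le hC_compact (fun k hk => (hAV _ (hφ1 j) k hk).2)
      (r := r (φ j)) rfl htI
    refine hC_subsmooth.neg_mem_clarkeNormalCone_of_tendsto hC_lip htI (hyC t htI)
      (s := fun j => node T (φ j) (stepIndex T (φ j) t + 1))
      (fun j => node_mem_Icc hT (hφ1 j)
        (stepIndex_lt hT (hφ1 j) htI)) ?_ (M := R + V) hξ (fun j => ?_) ?_ ?_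
      (fun N => (htconv N).2)
    · rw [tendsto_iff_dist_tendsto_zero]
      exact squeeze_zero (fun _ => dist_nonneg) (fun j =>
        (abs_node_stepIndex_succ_sub_le hT (hφ1 j) htI.1).1) (hμ.comp hφt)
    · have h1 := norm_sub_le (ξ j + projVelocity T f (φ j) (p (φ j)) t)
        (projVelocity T f (φ j) (p (φ j)) t)
      rw [add_sub_cancel_right] at h1
      have h2 : r (φ j) ≤ R := hR ⟨_, rfl⟩
      linarith [hξb j, hb' (φ j) (hφ1 j) t htI]
    · have h1 : Tendsto (fun j => dist (u j)
          (p (φ j) (stepIndex T (φ j) t + 1))) atTop (𝓝 0) := by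
        refine squeeze_zero (fun _ => dist_nonneg) (fun j => (dist_eq_norm _ _).trans_le (hu j)) ?_
        have := (hr0.mul hμ).comp hφt
        rwa [mul_zero] at this
      exact (tendsto_iff_of_dist h1).2 (hiter _ fun j =>
        ((hx (φ j) (hφ1 j)).dist_apply_le hT (hφ1 j) (hlip _ (hφ1 j)) htI).1)
    · exact squeeze_zero_norm hξb (hr0.comp hφt)
  · exact (hF_usc t htI).mem_of_tendsto (hF_closed t htI _) (hF_convex t htI _)
      (hiter _ fun j => ((hx (φ j) (hφ1 j)).dist_apply_le hT (hφ1 j) (hlip _ (hφ1 j)) htI).2)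
      (fun j => (hf_sel t htI _).1) fun N => (htconv N).1
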